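/- Let $M$ be a smooth (Hausdorff) finite-dimensional manifold with tangent bundle $\pi\colon TM\to M$, let $A\subseteq TM$ be open (its elements are called observers), and let $VA=\ker(d\pi)|_A$. Let $HA\subseteq TA$ be a nonlinear connection on $A$, i.e. a smooth subbundle with $TA=HA\oplus VA$. An $A$-anisotropic vector field $X$ (resp. $s$-form $\omega$) assigns to each $v\in A$, smoothly in $v$, a vector $X_v\in T_{\pi(v)}M$ (resp. an alternating $s$-linear form $\omega_v$ on $T_{\pi(v)}M$); vector fields on $M$ are regarded as the (isotropic) anisotropic vector fields $v\mapsto X_{\pi(v)}$. For an anisotropic vector field $X$, the horizontal lift $X^{H}$ is the section of $HA$ with $d\pi_v(X^{H}_v)=X_v$. The anisotropic Lie bracket of anisotropic vector fields $Z,X$ is $(\mathfrak l^{H}_ZX)_v:=d\pi_v\big([Z^{H},X^{H}]_v\big)$, and that of $Z$ and an anisotropic $s$-form $\omega$ is the anisotropic $s$-form $\mathfrak l^{H}_Z\omega$ given by $$(\mathfrak l^{H}_Z\omega)(X_1,\dots,X_s)=Z^{H}\big(\omega(X_1,\dots,X_s)\big)-\sum_{\nu=1}^s\omega(X_1,\dots,\mathfrak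 l^{H}_ZX_\nu,\dots,X_s)$$ for all (local) smooth vector fields $X_1,\dots,X_s$ on $M$. Let $Z$ be a smooth vector field on $M$, with (possibly only local) flow $\psi_t$. For $v\in A$ and $|t|$ small, let $P_t(v)\in T_{\psi_t(\pi(v))}M$ be the $HA$-parallel transport of $v$ along the integral curve $\tau\mapsto\psi_\tau(\pi(v))$ of $Z$, i.e. the value at $t$ of the vector field $V$ along this curve with $V(0)=v$, with values in $A$, and whose velocity as a curve in $A$ lies in $HA$. For an anisotropic $s$-form $\omega$ put $$(\psi_t^*\omega)_v(u_1,\dots,u_s):=\omega_{P_t(v)}\big(d\psi_t(u_1),\dots,d\psi_t(u_s)\big),\qquad u_1,\dots,u_s\in T_{\pi(v)}M.$$ Then, for every smooth anisotropic $s$-form $\omega$ ($s\ge 0$) and every $v\in A$, $$(\mathfrak l^{H}_Z\omega)_v=\lim_{t\to0}\frac{(\psi_t^*\omega)_v-\omega_v}{t}.$$ -/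

import Mathlib

open Set Filter Topology Manifold Bundle
open scoped ContDiff

noncomputable section

namespace AnisotropicLie

/-! `M` is a smooth manifold without boundary modelled on the finite-dimensional real vector
space `E`, and `A` is a set of tangent vectors (the observers). Objects on `A` are represented by
functions on the whole tangent bundle, whose values outside `A` are irrelevant. -/

variable {E : Type*} [NormedAddCommGroup E] [NormedSpace ℝ E]
  {M : Type*} [TopologicalSpace M] [ChartedSpace E M] [IsManifold 𝓘(ℝ, E) ∞ M]

/-- The tangent vector field `X` on `M` is smooth on the set `U`. -/
def SmoothFieldOn (X : ∀ x : M, TangentSpace 𝓘(ℝ, E) x) (U : Set M) : Prop :=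
  ContMDiffOn 𝓘(ℝ, E) 𝓘(ℝ, E).tangent ∞
    (fun x => (⟨x, X x⟩ : TangentBundle 𝓘(ℝ, E) M)) U

/-- The differential at `v` of the canonical projection `π : TM → M`. -/
def dproj (v : TangentBundle 𝓘(ℝ, E) M) :
    TangentSpace 𝓘(ℝ, E).tangent v →L[ℝ] TangentSpace 𝓘(ℝ, E) v.proj :=
  mfderiv 𝓘(ℝ, E).tangent 𝓘(ℝ, E)
    (fun w : TangentBundle 𝓘(ℝ, E) M => w.proj) v

/-- The vertical subspace `V_v A = ker dπ_v`. -/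
def verticalSpace (v : TangentBundle 𝓘(ℝ, E) M) :
    Submodule ℝ (TangentSpace 𝓘(ℝ, E).tangent v) :=
  LinearMap.ker (dproj v : TangentSpace 𝓘(ℝ, E).tangent v →ₗ[ℝ] TangentSpace 𝓘(ℝ, E) v.proj)

/-- A nonlinear connection on `A → M`: a smooth (horizontal) subbundle `HA` of `TA` such that
`TA = HA ⊕ VA`. Smoothness is the existence of smooth local frames of `HA`. -/
structure NonlinearConnection (A : Set (TangentBundle 𝓘(ℝ, E) M)) where
  /-- the horizontal subspace `H_v A` of `T_v A` -/
  horizontal : ∀ v : TangentBundle 𝓘(ℝ, E) M, Submodule ℝ (TangentSpace 𝓘(ℝ, E).tangent v)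
  isCompl : ∀ v ∈ A, IsCompl (horizontal v) (verticalSpace v)
  exists_frame : ∀ v₀ ∈ A, ∃ O : Set (TangentBundle 𝓘(ℝ, E) M), IsOpen O ∧ v₀ ∈ O ∧
    ∃ Y : Fin (Module.finrank ℝ E) → ∀ v : TangentBundle 𝓘(ℝ, E) M,
        TangentSpace 𝓘(ℝ, E).tangent v,
      (∀ i, ContMDiffOn 𝓘(ℝ, E).tangent 𝓘(ℝ, E).tangent.tangent ∞
        (fun v => (⟨v, Y i v⟩ :
          TangentBundle 𝓘(ℝ, E).tangent (TangentBundle 𝓘(ℝ, E) M))) O) ∧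
      ∀ v ∈ O ∩ A, horizontal v = Submodule.span ℝ (range fun i => Y i v)

/-- A smooth `A`-anisotropic `s`-form: an alternating `s`-linear form `η_v` on `T_{π(v)} M` for
each `v ∈ A`, depending smoothly on `v`, i.e. such that `v ↦ η_v(X₁, …, X_s)` is smooth for all
smooth local vector fields `X₁, …, X_s` on `M`. -/
structure AnisotropicForm (A : Set (TangentBundle 𝓘(ℝ, E) M)) (s : ℕ) where
  /-- the value `η_v` -/
  form : ∀ v : TangentBundle 𝓘(ℝ, E) M, TangentSpace 𝓘(ℝ, E) v.proj [⋀^Fin s]→ₗ[ℝ] ℝ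
  smooth : ∀ (U : Set M), IsOpen U → ∀ X : Fin s → ∀ x : M, TangentSpace 𝓘(ℝ, E) x,
    (∀ i, SmoothFieldOn (X i) U) →
      ContMDiffOn 𝓘(ℝ, E).tangent 𝓘(ℝ, ℝ) ∞
        (fun v : TangentBundle 𝓘(ℝ, E) M => form v fun i => X i v.proj)
        (A ∩ {v | v.proj ∈ U})

/-- The anisotropic vector field (`v ↦` a vector of `T_{π(v)} M`) given by a vector field on
`M`; such anisotropic fields are called isotropic. -/
def isotropic (X : ∀ x : M, TangentSpace 𝓘(ℝ, E) x) :
    ∀ v : TangentBundle 𝓘(ℝ, E) M, TangentSpace 𝓘(ℝ, E) v.proj :=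
  fun v => X v.proj

namespace NonlinearConnection

variable {A : Set (TangentBundle 𝓘(ℝ, E) M)} (N : NonlinearConnection A)

open Classical in
/-- The horizontal lift `Z^H` of an anisotropic vector field `Z`: for `v ∈ A`, `Z^H_v` is the only
vector of `H_v A` which `dπ_v` maps to `Z_v`. -/
def horizontalLift (Z : ∀ v : TangentBundle 𝓘(ℝ, E) M, TangentSpace 𝓘(ℝ, E) v.proj)
    (v : TangentBundle 𝓘(ℝ, E) M) : TangentSpace 𝓘(ℝ, E).tangent v :=
  if h : ∃ w ∈ N.horizontal v, dproj v w = Z v then h.choose else 0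

/-- The anisotropic Lie bracket `𝔩^H_Z X` of two anisotropic vector fields: the anisotropic vector
field given by the horizontal part of the commutator `[Z^H, X^H]`, i.e. by its image under `dπ`. -/
def lieBracketField (Z X : ∀ v : TangentBundle 𝓘(ℝ, E) M, TangentSpace 𝓘(ℝ, E) v.proj)
    (v : TangentBundle 𝓘(ℝ, E) M) : TangentSpace 𝓘(ℝ, E) v.proj :=
  dproj v (VectorField.mlieBracket 𝓘(ℝ, E).tangent
    (N.horizontalLift Z) (N.horizontalLift X) v)

/-- The value at `v` of the anisotropic Lie bracket `𝔩^H_Z η` of an anisotropic form on the vector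
fields `X₁, …, X_s` of `M`:
`(𝔩^H_Z η)(X₁, …, X_s) = Z^H(η(X₁, …, X_s)) - ∑ ν, η(X₁, …, 𝔩^H_Z X_ν, …, X_s)`. -/
def lieBracketForm {s : ℕ}
    (Z : ∀ v : TangentBundle 𝓘(ℝ, E) M, TangentSpace 𝓘(ℝ, E) v.proj)
    (η : AnisotropicForm A s) (X : Fin s → ∀ x : M, TangentSpace 𝓘(ℝ, E) x)
    (v : TangentBundle 𝓘(ℝ, E) M) : ℝ :=
  (show ℝ from mfderiv 𝓘(ℝ, E).tangent 𝓘(ℝ, ℝ)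
      (fun w : TangentBundle 𝓘(ℝ, E) M => η.form w fun i => X i w.proj) v
      (N.horizontalLift Z v)) -
    ∑ ν : Fin s, η.form v (Function.update (fun i => X i v.proj) ν
      (N.lieBracketField Z (isotropic (X ν)) v))

/-- `V`, a vector field along the curve `γ`, is a parallel observer field on the time set `J`:
it takes values in `A` and its velocity, as a curve in `A`, is horizontal. -/
def IsParallelOn (γ : ℝ → M) (V : ∀ t : ℝ, TangentSpace 𝓘(ℝ, E) (γ t)) (J : Set ℝ) : Prop :=
  ∀ t ∈ J, (⟨γ t, V t⟩ : TangentBundle 𝓘(ℝ, E) M) ∈ A ∧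
    MDifferentiableAt 𝓘(ℝ, ℝ) 𝓘(ℝ, E).tangent
      (fun τ => (⟨γ τ, V τ⟩ : TangentBundle 𝓘(ℝ, E) M)) t ∧
    mfderiv 𝓘(ℝ, ℝ) 𝓘(ℝ, E).tangent
      (fun τ => (⟨γ τ, V τ⟩ : TangentBundle 𝓘(ℝ, E) M)) t (1 : ℝ) ∈ N.horizontal ⟨γ t, V t⟩

open Classical in
/-- The parallel transport `P_t(v) ∈ T_{γ(t)} M` along `γ` of an observer `v` at `γ(0)`: the
value at `t` of a parallel observer field, on an open interval containing `0` and `t`, which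
starts at `v`. (If there is none, then `P_t(v)` is not defined, and takes the value `0`.) -/
def parallelTransport (γ : ℝ → M) (t : ℝ) (v : TangentBundle 𝓘(ℝ, E) M) :
    TangentSpace 𝓘(ℝ, E) (γ t) :=
  if h : ∃ V : ∀ τ : ℝ, TangentSpace 𝓘(ℝ, E) (γ τ),
      (⟨γ 0, V 0⟩ : TangentBundle 𝓘(ℝ, E) M) = v ∧
      ∃ a b : ℝ, 0 ∈ Ioo a b ∧ t ∈ Ioo a b ∧ N.IsParallelOn γ V (Ioo a b)
  then h.choose t else 0

end NonlinearConnection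

open Classical in
/-- The (maximal, possibly only local) flow `ψ_t(x)` of the vector field `Z`: the value at `t` of
an integral curve of `Z`, on an open interval containing `0` and `t`, which starts at `x`.
(If there is none, then `ψ_t(x)` is not defined, and takes the value `x`.) -/
def flow (Z : ∀ x : M, TangentSpace 𝓘(ℝ, E) x) (t : ℝ) (x : M) : M :=
  if h : ∃ γ : ℝ → M, γ 0 = x ∧
      ∃ a b : ℝ, 0 ∈ Ioo a b ∧ t ∈ Ioo a b ∧ IsMIntegralCurveOn γ Z (Ioo a b)
  then h.choose t else x

/-- The pullback by the flow `ψ_t` of `Z` of an anisotropic form: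
`(ψ_t^* η)_v(u₁, …, u_s) = η_{P_t(v)}(dψ_t(u₁), …, dψ_t(u_s))`, where `P_t(v)` is the parallel
transport of `v` along the integral curve `τ ↦ ψ_τ(π(v))` of `Z`. -/
def flowPullback {A : Set (TangentBundle 𝓘(ℝ, E) M)} (N : NonlinearConnection A)
    (Z : ∀ x : M, TangentSpace 𝓘(ℝ, E) x) (t : ℝ) {s : ℕ} (η : AnisotropicForm A s)
    (v : TangentBundle 𝓘(ℝ, E) M) : TangentSpace 𝓘(ℝ, E) v.proj [⋀^Fin s]→ₗ[ℝ] ℝ :=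
  (η.form ⟨flow Z t v.proj, N.parallelTransport (fun τ => flow Z τ v.proj) t v⟩).compLinearMap
    (mfderiv 𝓘(ℝ, E) 𝓘(ℝ, E) (flow Z t) v.proj :
      TangentSpace 𝓘(ℝ, E) v.proj →L[ℝ] TangentSpace 𝓘(ℝ, E) (flow Z t v.proj)).toLinearMap

end AnisotropicLie

end

noncomputable section

namespace AnisotropicLie

/-! Parallel transport of `v` along the flow of `Z` is the integral curve `W` of `Z^H` through `v`:
a horizontal velocity which projects to `Z` is the lift of `Z` (`mk_parallelTransport_eq`). In the
chart at `π(v)`, write `Ω_w` for the form, `z` for `Z` and `D_t` for `dψ_t`. The pullback becomes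
`Ω_{W t}(D_t u₁, …, D_t u_s)`, with `D_0 = id` and `D'_0 = dz` (`exists_hasDerivAt_mfderiv_flow`, by
the first variation equation). The product rule `hasDerivAt_multilinear_apply` gives its derivative
at `0`: `(Z^H Ω)(u) + ∑ Ω(…, dz(u_i), …)`.

The bracket has the same value (`lieBracketForm_eq`). Differentiating `Ω(X₁, …, X_s)` along `W`
yields `(Z^H Ω)(X) + ∑ Ω(…, dX_i(Z), …)`, while `𝔩^H_Z X_i` reads `dX_i(Z) - dz(X_i)`
(`chartReading_lieBracketField`), so the terms in `dX_i(Z)` cancel. The connection does not enter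
this last formula: `dπ[Z^H, X^H]` is tested on functions pulled back from `M`, which see only
projections. -/

/-! ### Differentiability of a local flow in its initial value -/

lemma gronwallBound_zero_mul (K c e x : ℝ) :
    gronwallBound 0 K (c * e) x = c * gronwallBound 0 K e x := by
  by_cases hK : K = 0
  · subst hK; simp only [gronwallBound_K0]; ring
  · simp only [gronwallBound_of_K_ne_0 hK]; ring

/-- Grönwall's inequality on both sides of the initial time. -/
lemma norm_le_gronwallBound_abs {F : Type*} [NormedAddCommGroup F] [NormedSpace ℝ F]
    {r r' : ℝ → F} {C e ε : ℝ} (hr : ∀ t ∈ Ioo (-ε) ε, HasDerivAt r (r' t) t) (h0 : r 0 = 0)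
    (hb : ∀ t ∈ Ioo (-ε) ε, ‖r' t‖ ≤ C * ‖r t‖ + e) {t : ℝ} (ht : t ∈ Ioo (-ε) ε) :
    ‖r t‖ ≤ gronwallBound 0 C e |t| := by
  rcases le_total 0 t with h | h
  · have hs : ∀ τ ∈ Icc 0 t, τ ∈ Ioo (-ε) ε := fun τ hτ => by
      constructor <;> linarith [hτ.1, hτ.2, ht.1, ht.2]
    have := norm_le_gronwallBound_of_norm_deriv_right_le (f := r) (f' := r') (a := 0) (b := t)
      (δ := 0) (K := C) (ε := e)
      (fun τ hτ => (hr τ (hs τ hτ)).continuousAt.continuousWithinAt)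
      (fun τ hτ => (hr τ (hs τ (Ico_subset_Icc_self hτ))).hasDerivWithinAt) (by simp [h0])
      (fun τ hτ => hb τ (hs τ (Ico_subset_Icc_self hτ))) t ⟨h, le_rfl⟩
    simpa [abs_of_nonneg h] using this
  · have hs : ∀ τ ∈ Icc 0 (-t), -τ ∈ Ioo (-ε) ε := fun τ hτ => by
      constructor <;> linarith [hτ.1, hτ.2, ht.1, ht.2]
    have hd : ∀ τ ∈ Icc 0 (-t), HasDerivAt (fun τ => r (-τ)) (-r' (-τ)) τ := fun τ hτ => by
      simpa [Function.comp_def] using (hr (-τ) (hs τ hτ)).scomp τ (hasDerivAt_neg τ)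
    have := norm_le_gronwallBound_of_norm_deriv_right_le (f := fun τ => r (-τ))
      (f' := fun τ => -r' (-τ)) (a := 0) (b := -t) (δ := 0) (K := C) (ε := e)
      (fun τ hτ => (hd τ hτ).continuousAt.continuousWithinAt)
      (fun τ hτ => (hd τ (Ico_subset_Icc_self hτ)).hasDerivWithinAt) (by simp [h0])
      (fun τ hτ => by simpa using hb (-τ) (hs τ (Ico_subset_Icc_self hτ))) (-t)
      ⟨by linarith, le_rfl⟩
    simpa [abs_of_nonpos h] using this

/-- A `C²` vector field near `x₀` has a local flow which is differentiable in the initial value at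
`x₀`, and the derivative is given at first order in time by that of the vector field. -/
theorem exists_localFlow_hasFDerivAt {F : Type*} [NormedAddCommGroup F] [NormedSpace ℝ F]
    [CompleteSpace F] {f : F → F} {x₀ : F} (hf : ContDiffAt ℝ 2 f x₀) {u : Set F}
    (hu : u ∈ 𝓝 x₀) :
    ∃ ε > (0 : ℝ), ∃ α : F → ℝ → F, ∃ D : ℝ → F →L[ℝ] F,
      (∀ᶠ x in 𝓝 x₀, α x 0 = x ∧
        ∀ t ∈ Ioo (-ε) ε, HasDerivAt (α x) (f (α x t)) t ∧ α x t ∈ u) ∧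
      (∀ t ∈ Ioo (-ε) ε, HasFDerivAt (fun x => α x t) (D t) x₀) ∧
      HasDerivAt D (fderiv ℝ f x₀) 0 := by
  have hf' : ContDiffAt ℝ 1 (fderiv ℝ f) x₀ := hf.fderiv_right (by norm_num [one_add_one_eq_two])
  -- The system is augmented by its first variation equation. `G` is still `C¹`, so one application
  -- of Picard–Lindelöf gives both the flow `α` and the candidate `D` for its differential.
  set G : F × (F →L[ℝ] F) → F × (F →L[ℝ] F) := fun p => (f p.1, (fderiv ℝ f p.1).comp p.2) with hG
  have hGd : ContDiffAt ℝ 1 G (x₀, ContinuousLinearMap.id ℝ F) := by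
    have h1 : ContDiffAt ℝ 1 (fun p : F × (F →L[ℝ] F) => f p.1)
        (x₀, ContinuousLinearMap.id ℝ F) :=
      ContDiffAt.comp (g := f) (f := Prod.fst) _ (hf.of_le (by norm_num)) contDiffAt_fst
    have h2 : ContDiffAt ℝ 1 (fun p : F × (F →L[ℝ] F) => fderiv ℝ f p.1)
        (x₀, ContinuousLinearMap.id ℝ F) :=
      ContDiffAt.comp (g := fderiv ℝ f) (f := Prod.fst) _ hf' contDiffAt_fst
    exact h1.prodMk (h2.clm_comp contDiffAt_snd)
  obtain ⟨ε₁, hε₁, a, r, L, K, hr, hpl⟩ := IsPicardLindelof.of_contDiffAt_one hGd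
  obtain ⟨Φ, hΦ, L', hL'⟩ :=
    (hpl 0).exists_forall_mem_closedBall_eq_hasDerivWithinAt_lipschitzOnWith
  simp only [zero_sub, zero_add] at hΦ hL'
  set ι := ContinuousLinearMap.id ℝ F with hι
  set α : F → ℝ → F := fun x t => (Φ (x, ι) t).1 with hα
  set D : ℝ → F →L[ℝ] F := fun t => (Φ (x₀, ι) t).2 with hD
  have hmem : ∀ x ∈ Metric.closedBall x₀ (r : ℝ), (x, ι) ∈ Metric.closedBall (x₀, ι) (r : ℝ) := by
    intro x hx
    simpa [Prod.dist_eq] using hx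
  have hx₀ : x₀ ∈ Metric.closedBall x₀ (r : ℝ) := Metric.mem_closedBall_self r.2
  have hΦd : ∀ x ∈ Metric.closedBall x₀ (r : ℝ), ∀ t ∈ Ioo (-ε₁) ε₁,
      HasDerivAt (Φ (x, ι)) (G (Φ (x, ι) t)) t := fun x hx t ht =>
    ((hΦ _ (hmem x hx)).2 t (Ioo_subset_Icc_self ht)).hasDerivAt (Icc_mem_nhds ht.1 ht.2)
  have hαd : ∀ x ∈ Metric.closedBall x₀ (r : ℝ), ∀ t ∈ Ioo (-ε₁) ε₁,
      HasDerivAt (α x) (f (α x t)) t := fun x hx t ht => (hΦd x hx t ht).fst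
  have hDd : ∀ t ∈ Ioo (-ε₁) ε₁, HasDerivAt D ((fderiv ℝ f (α x₀ t)).comp (D t)) t :=
    fun t ht => (hΦd x₀ hx₀ t ht).snd
  have hα0 : ∀ x ∈ Metric.closedBall x₀ (r : ℝ), α x 0 = x := fun x hx => by
    simp [hα, (hΦ _ (hmem x hx)).1]
  have hD0 : D 0 = ι := by simp [hD, (hΦ _ (hmem x₀ hx₀)).1]
  have hαL : ∀ x ∈ Metric.closedBall x₀ (r : ℝ), ∀ t ∈ Ioo (-ε₁) ε₁,
      ‖α x t - α x₀ t‖ ≤ L' * ‖x - x₀‖ := fun x hx t ht => by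
    have h := (hL' t (Ioo_subset_Icc_self ht)).dist_le_mul _ (hmem x hx) _ (hmem x₀ hx₀)
    rw [Prod.dist_eq, Prod.dist_eq] at h
    have h' := (le_max_left _ _).trans h
    simpa [dist_eq_norm] using h'
  -- a ball on which `f` and its derivative are controlled
  obtain ⟨K', s, hs, hlip⟩ := hf'.exists_lipschitzOnWith
  have hdiff : ∀ᶠ y in 𝓝 x₀, DifferentiableAt ℝ f y :=
    (hf.eventually (by simp)).mono fun y hy => hy.differentiableAt (by norm_num)
  obtain ⟨C, hC⟩ : ∃ C : ℝ, ∀ᶠ y in 𝓝 x₀, ‖fderiv ℝ f y‖ ≤ C := by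
    refine ⟨‖fderiv ℝ f x₀‖ + 1, ?_⟩
    have := hf'.continuousAt.norm
    exact (this.eventually (gt_mem_nhds (lt_add_one _))).mono fun _ h => le_of_lt h
  obtain ⟨ρ, hρ, hball⟩ := Metric.mem_nhds_iff.1
    (Filter.inter_mem (Filter.inter_mem hs hu) (Filter.inter_mem hdiff hC))
  have htaylor : ∀ p ∈ Metric.ball x₀ ρ, ∀ q ∈ Metric.ball x₀ ρ,
      ‖f q - f p - fderiv ℝ f p (q - p)‖ ≤ K' * ‖q - p‖ ^ 2 := by
    intro p hp q hq
    have hseg : segment ℝ p q ⊆ Metric.ball x₀ ρ := (convex_ball x₀ ρ).segment_subset hp hq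
    have := (convex_segment p q).norm_image_sub_le_of_norm_hasFDerivWithin_le'
      (f := f) (f' := fderiv ℝ f) (φ := fderiv ℝ f p) (C := K' * ‖q - p‖) (x := p) (y := q)
      (fun z hz => ((hball (hseg hz)).2.1 : DifferentiableAt ℝ f z).hasFDerivAt.hasFDerivWithinAt)
      (fun z hz => by
        have h1 := hlip.dist_le_mul z (hball (hseg hz)).1.1 p (hball hp).1.1
        rw [dist_eq_norm] at h1
        refine h1.trans ?_
        gcongr
        rw [dist_comm]
        have := norm_sub_le_of_mem_segment hz
        rw [dist_comm, dist_eq_norm]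
        exact this)
      (left_mem_segment ℝ p q) (right_mem_segment ℝ p q)
    rw [sq, ← mul_assoc]
    exact this
  -- The reference orbit stays in the half ball; the Lipschitz bound `hαL` then keeps nearby orbits
  -- in the whole ball.
  obtain ⟨ε₂, hε₂, hε₂'⟩ : ∃ ε₂ > 0, ∀ t ∈ Ioo (-ε₂) ε₂, α x₀ t ∈ Metric.ball x₀ (ρ / 2) := by
    have hc : ContinuousAt (α x₀) 0 := (hαd x₀ hx₀ 0 ⟨by linarith, hε₁⟩).continuousAt
    have := hc.preimage_mem_nhds (t := Metric.ball x₀ (ρ / 2))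
      (by rw [hα0 x₀ hx₀]; exact Metric.ball_mem_nhds _ (by positivity))
    obtain ⟨ε₂, h, h'⟩ := Metric.mem_nhds_iff.1 this
    exact ⟨ε₂, h, fun t ht => h' (by rw [Real.ball_eq_Ioo]; simpa using ht)⟩
  set ε := min ε₁ ε₂ with hε
  have hεpos : 0 < ε := lt_min hε₁ hε₂
  have hsub1 : Ioo (-ε) ε ⊆ Ioo (-ε₁) ε₁ :=
    Ioo_subset_Ioo (neg_le_neg (min_le_left _ _)) (min_le_left _ _)
  have hsub2 : Ioo (-ε) ε ⊆ Ioo (-ε₂) ε₂ :=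
    Ioo_subset_Ioo (neg_le_neg (min_le_right _ _)) (min_le_right _ _)
  have hsmall : ∀ᶠ x in 𝓝 x₀, x ∈ Metric.closedBall x₀ (r : ℝ) ∧
      ∀ t ∈ Ioo (-ε) ε, α x t ∈ Metric.ball x₀ ρ := by
    have h2 : ∀ᶠ x in 𝓝 x₀, L' * ‖x - x₀‖ < ρ / 2 := by
      have : Tendsto (fun x => (L' : ℝ) * ‖x - x₀‖) (𝓝 x₀) (𝓝 (L' * ‖x₀ - x₀‖)) :=
        Continuous.tendsto (by fun_prop) x₀
      refine this.eventually (gt_mem_nhds ?_)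
      simp [hρ]
    filter_upwards [Metric.closedBall_mem_nhds x₀ (NNReal.coe_pos.2 hr), h2] with x hx hx2
    refine ⟨hx, fun t ht => ?_⟩
    have h1 := hαL x hx t (hsub1 ht)
    have h3 := hε₂' t (hsub2 ht)
    rw [Metric.mem_ball] at h3 ⊢
    have h4 := dist_triangle (α x t) (α x₀ t) x₀
    rw [dist_eq_norm (α x t) (α x₀ t)] at h4
    linarith
  refine ⟨ε, hεpos, α, D, ?_, ?_, ?_⟩
  · filter_upwards [hsmall] with x hx
    exact ⟨hα0 x hx.1, fun t ht => ⟨hαd x hx.1 t (hsub1 ht), (hball (hx.2 t ht)).1.2⟩⟩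
  · intro t ht
    -- The error `r = α x t - α x₀ t - D t (x - x₀)` satisfies the linearized equation up to a
    -- Taylor remainder of size `‖x - x₀‖²`, and `r 0 = 0`; Grönwall makes it quadratic in `x - x₀`.
    have key : ∀ᶠ x in 𝓝 x₀, ‖α x t - α x₀ t - D t (x - x₀)‖ ≤
        gronwallBound 0 C (K' * L' ^ 2) |t| * ‖x - x₀‖ ^ 2 := by
      filter_upwards [hsmall] with x hx
      have := norm_le_gronwallBound_abs (ε := ε) (C := C) (e := ‖x - x₀‖ ^ 2 * (K' * L' ^ 2))
        (r := fun t => α x t - α x₀ t - D t (x - x₀))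
        (r' := fun t => f (α x t) - f (α x₀ t) - (fderiv ℝ f (α x₀ t)).comp (D t) (x - x₀))
        (fun τ hτ => ((hαd x hx.1 τ (hsub1 hτ)).sub (hαd x₀ hx₀ τ (hsub1 hτ))).sub
          ((hDd τ (hsub1 hτ)).clm_apply (hasDerivAt_const τ (x - x₀)) |>.congr_deriv (by simp)))
        (by simp [hα0 x hx.1, hα0 x₀ hx₀, hD0, hι])
        (fun τ hτ => by
          have hp := hsmall.self_of_nhds.2 τ hτ
          have h1 := htaylor _ hp _ (hx.2 τ hτ)
          have h2 := hαL x hx.1 τ (hsub1 hτ)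
          have h3 : ‖fderiv ℝ f (α x₀ τ)‖ ≤ C := (hball hp).2.2
          have heq : f (α x τ) - f (α x₀ τ) - (fderiv ℝ f (α x₀ τ)).comp (D τ) (x - x₀) =
              fderiv ℝ f (α x₀ τ) (α x τ - α x₀ τ - D τ (x - x₀)) +
              (f (α x τ) - f (α x₀ τ) - fderiv ℝ f (α x₀ τ) (α x τ - α x₀ τ)) := by
            simp only [ContinuousLinearMap.comp_apply, map_sub]; abel
          rw [heq]
          refine (norm_add_le _ _).trans (add_le_add ?_ (h1.trans ?_))
          · exact (ContinuousLinearMap.le_opNorm _ _).trans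
              (mul_le_mul_of_nonneg_right h3 (norm_nonneg _))
          · calc (K' : ℝ) * ‖α x τ - α x₀ τ‖ ^ 2 ≤ K' * (L' * ‖x - x₀‖) ^ 2 := by gcongr
              _ = ‖x - x₀‖ ^ 2 * (K' * L' ^ 2) := by ring)
        ht
      -- With zero initial error the bound is linear in the inhomogeneity, so `‖x - x₀‖ ^ 2` factors
      -- out.
      rw [gronwallBound_zero_mul] at this
      simpa only [mul_comm] using this
    refine HasFDerivAt.of_isLittleO ?_
    have hO : (fun x => α x t - α x₀ t - D t (x - x₀)) =O[𝓝 x₀] fun x => ‖x - x₀‖ ^ 2 :=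
      Asymptotics.IsBigO.of_bound _ (key.mono fun x hx => by simpa using hx)
    refine hO.trans_isLittleO ?_
    have := Asymptotics.isLittleO_pow_sub_sub x₀ (one_lt_two)
    simpa using this
  · have h0 : (0 : ℝ) ∈ Ioo (-ε₁) ε₁ := ⟨by linarith, hε₁⟩
    have := hDd 0 h0
    rw [hD0, hα0 x₀ hx₀, hι, ContinuousLinearMap.comp_id] at this
    exact this

/-! ### Product rule for curves of multilinear maps -/

section Multilinear

variable {E : Type*} [NormedAddCommGroup E] [NormedSpace ℝ E] [FiniteDimensional ℝ E]
  {ι : Type*} [Fintype ι] [DecidableEq ι]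

/-- A family of multilinear maps converging pointwise converges along converging arguments. -/
lemma tendsto_multilinear_apply {α : Type*} {l : Filter α}
    {S : α → MultilinearMap ℝ (fun _ : ι => E) ℝ} {S' : (ι → E) → ℝ}
    (hS : ∀ u, Tendsto (fun t => S t u) l (𝓝 (S' u))) {U : α → ι → E} {u : ι → E}
    (hU : ∀ i, Tendsto (fun t => U t i) l (𝓝 (u i))) :
    Tendsto (fun t => S t (U t)) l (𝓝 (S' u)) := by
  classical
  by_cases hl : l = ⊥
  · simp [hl]
  have : l.NeBot := ⟨hl⟩
  let b := Module.finBasis ℝ E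
  -- In a basis, finitely many values determine the map, so pointwise convergence is enough.
  have hexp : ∀ (T : MultilinearMap ℝ (fun _ : ι => E) ℝ) (w : ι → E),
      T w = ∑ J : ι → Fin (Module.finrank ℝ E), (∏ i, b.repr (w i) (J i)) * T (fun i => b (J i)) := by
    intro T w
    conv_lhs => rw [show w = fun i => ∑ j, b.repr (w i) j • b j from
      funext fun i => (b.sum_repr (w i)).symm]
    rw [MultilinearMap.map_sum]
    refine Finset.sum_congr rfl fun J _ => ?_
    rw [MultilinearMap.map_smul_univ, smul_eq_mul]
  have hrepr : ∀ j, Continuous fun x : E => b.repr x j := fun j =>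
    (b.coord j).continuous_of_finiteDimensional
  have h1 : Tendsto (fun t => S t (U t)) l (𝓝 (∑ J : ι → Fin (Module.finrank ℝ E),
      (∏ i, b.repr (u i) (J i)) * S' (fun i => b (J i)))) := by
    simp only [fun t => hexp (S t) (U t)]
    exact tendsto_finsetSum _ fun J _ =>
      (tendsto_finsetProd _ fun i _ => ((hrepr (J i)).tendsto (u i)).comp (hU i)).mul (hS _)
  have h2 : Tendsto (fun t => S t u) l (𝓝 (∑ J : ι → Fin (Module.finrank ℝ E),
      (∏ i, b.repr (u i) (J i)) * S' (fun i => b (J i)))) := by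
    simp only [fun t => hexp (S t) u]
    exact tendsto_finsetSum _ fun J _ => tendsto_const_nhds.mul (hS _)
  -- `S'` is not assumed multilinear; uniqueness of limits identifies `S' u` with its expansion.
  rwa [tendsto_nhds_unique (hS u) h2]

/-- The product rule for a curve of multilinear maps, differentiable pointwise, evaluated at
differentiable arguments. -/
lemma hasDerivAt_multilinear_apply {T : ℝ → MultilinearMap ℝ (fun _ : ι => E) ℝ}
    {T' : (ι → E) → ℝ} {t₀ : ℝ} (hT : ∀ u, HasDerivAt (fun t => T t u) (T' u) t₀)
    {U : ℝ → ι → E} {U' : ι → E} (hU : ∀ i, HasDerivAt (fun t => U t i) (U' i) t₀) :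
    HasDerivAt (fun t => T t (U t))
      (T' (U t₀) + ∑ i, T t₀ (Function.update (U t₀) i (U' i))) t₀ := by
  -- The slope splits into the variation of `T` at the moving argument `U t` and the variation of `T
  -- t₀ (U t)`.
  have h1 : Tendsto (fun t => (t - t₀)⁻¹ * (T t (U t) - T t₀ (U t))) (𝓝[≠] t₀)
      (𝓝 (T' (U t₀))) := by
    refine tendsto_multilinear_apply (S := fun t => (t - t₀)⁻¹ • (T t - T t₀)) (fun u => ?_)
      (fun i => (hU i).continuousAt.tendsto.mono_left nhdsWithin_le_nhds)
    refine (hasDerivAt_iff_tendsto_slope.1 (hT u)).congr fun t => ?_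
    simp [slope_def_field, div_eq_inv_mul]
  have hc : Continuous (T t₀) := continuous_iff_continuousAt.2 fun u =>
    tendsto_multilinear_apply (S := fun _ : ι → E => T t₀) (S' := T t₀) (U := id)
      (fun _ => tendsto_const_nhds) fun i => (continuous_apply i).tendsto u
  let Tc : ContinuousMultilinearMap ℝ (fun _ : ι => E) ℝ := ⟨T t₀, hc⟩
  have h2 : HasDerivAt (fun t => T t₀ (U t)) (∑ i, T t₀ (Function.update (U t₀) i (U' i))) t₀ := by
    have := (Tc.hasFDerivAt (U t₀)).comp_hasDerivAt t₀ (hasDerivAt_pi.2 hU)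
    rw [ContinuousMultilinearMap.linearDeriv_apply] at this
    exact this
  rw [hasDerivAt_iff_tendsto_slope] at h2 ⊢
  refine (h1.add h2).congr fun t => ?_
  simp only [slope_def_field, div_eq_inv_mul]
  ring

end Multilinear

/-! ### The Lie bracket on a manifold as a commutator of derivations -/

section Commutator

variable {E : Type*} [NormedAddCommGroup E] [NormedSpace ℝ E]
  {H : Type*} [TopologicalSpace H] {I : ModelWithCorners ℝ E H}
  {N : Type*} [TopologicalSpace N] [ChartedSpace H N] [IsManifold I ∞ N]
  {G : Type*} [NormedAddCommGroup G] [NormedSpace ℝ G]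

lemma hasMFDerivAt_of_eventuallyEq_comp_extChartAt {F : N → G} {f : E → G} {p q : N}
    (hq : q ∈ (extChartAt I p).source) (hf : DifferentiableAt ℝ f (extChartAt I p q))
    (hF : F =ᶠ[𝓝 q] f ∘ extChartAt I p) :
    HasMFDerivAt I 𝓘(ℝ, G) F q
      ((fderiv ℝ f (extChartAt I p q)).comp (mfderiv I 𝓘(ℝ, E) (extChartAt I p) q)) := by
  have : IsManifold I 1 N := IsManifold.of_le (n := ∞) (by norm_num)
  have h1 : HasMFDerivAt I 𝓘(ℝ, E) (extChartAt I p) q _ :=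
    (mdifferentiableAt_extChartAt (by simpa using hq)).hasMFDerivAt
  exact (HasMFDerivAt.comp q hf.hasFDerivAt.hasMFDerivAt h1).congr_of_eventuallyEq hF

lemma mvfderiv_of_eventuallyEq_comp_extChartAt {F : N → G} {f : E → G} {p q : N}
    (hq : q ∈ (extChartAt I p).source) (hf : DifferentiableAt ℝ f (extChartAt I p q))
    (hF : F =ᶠ[𝓝 q] f ∘ extChartAt I p) (w : TangentSpace I q) :
    mvfderiv I F q w =
      fderiv ℝ f (extChartAt I p q) (mfderiv I 𝓘(ℝ, E) (extChartAt I p) q w) := by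
  have := (hasMFDerivAt_of_eventuallyEq_comp_extChartAt hq hf hF).mfderiv
  simp only [mvfderiv, this]
  rfl

/-- The differentiation operator along `[V, W]` is the commutator of the differentiation operators
along `V` and `W`. -/
lemma mvfderiv_apply_mlieBracket [CompleteSpace E] [I.Boundaryless] {F : N → G} {p : N}
    (hF : ContMDiffAt I 𝓘(ℝ, G) 2 F p) {V W : ∀ q : N, TangentSpace I q}
    (hV : MDifferentiableAt I I.tangent (fun q => (⟨q, V q⟩ : TangentBundle I N)) p)
    (hW : MDifferentiableAt I I.tangent (fun q => (⟨q, W q⟩ : TangentBundle I N)) p) :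
    mvfderiv I F p (VectorField.mlieBracket I V W p) =
      mvfderiv I (fun q => mvfderiv I F q (W q)) p (V p) -
        mvfderiv I (fun q => mvfderiv I F q (V q)) p (W p) := by
  have i1 : IsManifold I 1 N := IsManifold.of_le (n := ∞) (by norm_num)
  have i2 : IsManifold I 2 N := IsManifold.of_le (n := ∞) (by norm_cast)
  set φ := extChartAt I p with hφ
  set f : E → G := F ∘ φ.symm with hf
  have hp : p ∈ φ.source := mem_extChartAt_source p
  have hfd : ContDiffAt ℝ 2 f (φ p) := by
    have h1 : ContMDiffAt 𝓘(ℝ, E) I 2 φ.symm (φ p) :=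
      (contMDiffOn_extChartAt_symm p).contMDiffAt (extChartAt_target_mem_nhds p)
    have h2 : ContMDiffAt I 𝓘(ℝ, G) 2 F (φ.symm (φ p)) := by rwa [φ.left_inv hp]
    exact (h2.comp _ h1).contDiffAt
  have hsrc : ∀ᶠ q in 𝓝 p, q ∈ φ.source := extChartAt_source_mem_nhds p
  have hread : ∀ q ∈ φ.source, ∀ g : N → G, g =ᶠ[𝓝 q] (g ∘ φ.symm) ∘ φ := fun q hq g => by
    filter_upwards [extChartAt_source_mem_nhds' hq] with y hy
    simp [φ.left_inv hy]
  -- `Y'` is the field `Y` in coordinates. Once derivatives along `Y` become derivatives along `Y'`,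
  -- the claim is the commutator identity in `E`.
  have key : ∀ Y : ∀ q : N, TangentSpace I q,
      MDifferentiableAt I I.tangent (fun q => (⟨q, Y q⟩ : TangentBundle I N)) p →
      ∃ Y' : E → E, Y' = VectorField.mpullbackWithin 𝓘(ℝ, E) I φ.symm Y (range I) ∧
        DifferentiableAt ℝ Y' (φ p) ∧
        (∀ q ∈ φ.source, mfderiv I 𝓘(ℝ, E) φ q (Y q) = Y' (φ q)) ∧
        ∀ w : TangentSpace I p, mvfderiv I (fun q => mvfderiv I F q (Y q)) p w =
          fderiv ℝ (fun y => fderiv ℝ f y (Y' y)) (φ p) (mfderiv I 𝓘(ℝ, E) φ p w) := by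
    intro Y hY
    obtain ⟨Y', hY'⟩ : ∃ Y' : E → E,
        Y' = VectorField.mpullbackWithin 𝓘(ℝ, E) I φ.symm Y (range I) := ⟨_, rfl⟩
    have hY1 : DifferentiableAt ℝ Y' (φ p) := by
      have h := hY.mdifferentiableWithinAt (s := univ)
        |>.differentiableWithinAt_mpullbackWithin_vectorField
      rw [← hφ, preimage_univ, univ_inter] at h
      have h' : DifferentiableWithinAt ℝ Y' (range I) (φ p) := hY' ▸ h
      rwa [I.range_eq_univ, differentiableWithinAt_univ] at h'
    have hY2 : ∀ q ∈ φ.source, mfderiv I 𝓘(ℝ, E) φ q (Y q) = Y' (φ q) := by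
      intro q hq
      have hinv : (mfderivWithin 𝓘(ℝ, E) I φ.symm (range I) (φ q)).inverse =
          mfderiv I 𝓘(ℝ, E) φ (φ.symm (φ q)) :=
        ContinuousLinearMap.inverse_eq
          (mfderivWithin_extChartAt_symm_comp_mfderiv_extChartAt (φ.map_source hq))
          (mfderiv_extChartAt_comp_mfderivWithin_extChartAt_symm (φ.map_source hq))
      have h : Y' (φ q) = (mfderivWithin 𝓘(ℝ, E) I φ.symm (range I) (φ q)).inverse
        (Y (φ.symm (φ q))) := by rw [hY']; rfl
      have h' : ∀ q', q' = q →
          (mfderiv I 𝓘(ℝ, E) φ q (Y q) : E) = mfderiv I 𝓘(ℝ, E) φ q' (Y q') := by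
        rintro _ rfl; rfl
      rw [h, hinv]
      exact h' _ (φ.left_inv hq)
    refine ⟨Y', hY', hY1, hY2, ?_⟩
    refine mvfderiv_of_eventuallyEq_comp_extChartAt hp ?_ ?_
    · exact ((hfd.fderiv_right (m := 1) (by norm_num [one_add_one_eq_two])).differentiableAt
        (by norm_num)).clm_apply hY1
    · filter_upwards [hsrc, (continuousAt_extChartAt p).eventually
        (hfd.eventually (by simp))] with q hq hfq
      rw [mvfderiv_of_eventuallyEq_comp_extChartAt hq (hfq.differentiableAt (by norm_num))
        (hread q hq F), hY2 q hq]
      rfl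
  obtain ⟨V', hV', hV1, hV2, hV3⟩ := key V hV
  obtain ⟨W', hW', hW1, hW2, hW3⟩ := key W hW
  rw [hV3, hW3, hV2 p hp, hW2 p hp,
    mvfderiv_of_eventuallyEq_comp_extChartAt hp (hfd.differentiableAt (by norm_num)) (hread p hp F),
    ← VectorField.fderiv_apply_lieBracket hfd (by simp) hW1 hV1]
  congr 1
  have hbr : VectorField.mlieBracket I V W p =
      (mfderiv I 𝓘(ℝ, E) φ p).inverse (show E from VectorField.lieBracket ℝ V' W' (φ p)) := by
    rw [VectorField.mlieBracket, VectorField.mlieBracketWithin_apply, ← hφ, preimage_univ,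
      univ_inter]
    have h : VectorField.lieBracketWithin ℝ V' W' (range I) (φ p) =
        VectorField.lieBracket ℝ V' W' (φ p) := by
      rw [I.range_eq_univ, VectorField.lieBracketWithin_univ]
    rw [← h, hV', hW']
  rw [hbr]
  exact (isInvertible_mfderiv_extChartAt (I := I) hp).self_apply_inverse _

end Commutator

variable {E : Type*} [NormedAddCommGroup E] [NormedSpace ℝ E]
  {M : Type*} [TopologicalSpace M] [ChartedSpace E M] [IsManifold 𝓘(ℝ, E) ∞ M]

/-! ### Tangent vectors read in a chart -/

section ChartReading

/-- A tangent vector read in the chart at `x₀`. -/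
def chartReading (x₀ y : M) : TangentSpace 𝓘(ℝ, E) y →L[ℝ] E :=
  mvfderiv 𝓘(ℝ, E) (extChartAt 𝓘(ℝ, E) x₀) y

/-- The local vector field which is constant, equal to `u`, in the chart at `x₀`. -/
def chartField (x₀ : M) (u : E) (y : M) : TangentSpace 𝓘(ℝ, E) y :=
  (trivializationAt E (TangentSpace 𝓘(ℝ, E)) x₀).symmL ℝ y u

/-- Links two descriptions of the reading: the derivative of the chart serves the chain rule, the
trivialization serves inversion and smoothness. -/
lemma chartReading_eq_continuousLinearMapAt {x₀ y : M} (hy : y ∈ (chartAt E x₀).source) :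
    chartReading x₀ y =
      (trivializationAt E (TangentSpace 𝓘(ℝ, E)) x₀).continuousLinearMapAt ℝ y := by
  have i1 : IsManifold 𝓘(ℝ, E) 1 M := IsManifold.of_le (n := ∞) (by norm_num)
  rw [TangentBundle.continuousLinearMapAt_trivializationAt hy]
  rfl

lemma chartReading_apply {x₀ : M} {w : TangentBundle 𝓘(ℝ, E) M}
    (hy : w.proj ∈ (chartAt E x₀).source) :
    chartReading x₀ w.proj w.2 = (trivializationAt E (TangentSpace 𝓘(ℝ, E)) x₀ w).2 := by
  rw [chartReading_eq_continuousLinearMapAt hy]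
  exact Trivialization.continuousLinearMapAt_apply_of_mem ℝ
    (trivializationAt E (TangentSpace 𝓘(ℝ, E)) x₀) (by simpa using hy) w.2

lemma chartReading_chartField {x₀ y : M} (hy : y ∈ (chartAt E x₀).source) (u : E) :
    chartReading x₀ y (chartField x₀ u y) = u := by
  rw [chartReading_eq_continuousLinearMapAt hy]
  exact Trivialization.continuousLinearMapAt_symmL _ (by simpa using hy) u

lemma chartField_chartReading {x₀ y : M} (hy : y ∈ (chartAt E x₀).source)
    (w : TangentSpace 𝓘(ℝ, E) y) : chartField x₀ (chartReading x₀ y w) y = w := by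
  rw [chartReading_eq_continuousLinearMapAt hy]
  exact Trivialization.symmL_continuousLinearMapAt _ (by simpa using hy) w

lemma smoothFieldOn_chartField (x₀ : M) (u : E) :
    SmoothFieldOn (chartField x₀ u) (chartAt E x₀).source := by
  refine (Trivialization.contMDiffOn_section_baseSet_iff
    (trivializationAt E (TangentSpace 𝓘(ℝ, E)) x₀)).2 ?_
  refine (contMDiffOn_const (c := u)).congr fun y hy => ?_
  have hy' : y ∈ (chartAt E x₀).source := by simpa using hy
  rw [← chartReading_apply (w := ⟨y, chartField x₀ u y⟩) hy']
  exact chartReading_chartField hy' u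

lemma contMDiffAt_chartReading {F : Type*} [NormedAddCommGroup F] [NormedSpace ℝ F]
    {H : Type*} [TopologicalSpace H] {J : ModelWithCorners ℝ F H} {P : Type*} [TopologicalSpace P]
    [ChartedSpace H P] {n : ℕ∞ω} {b : P → M}
    {X : ∀ q, TangentSpace 𝓘(ℝ, E) (b q)} {p : P}
    (hX : ContMDiffAt J 𝓘(ℝ, E).tangent n
      (fun q => (⟨b q, X q⟩ : TangentBundle 𝓘(ℝ, E) M)) p) :
    ContMDiffAt J 𝓘(ℝ, E) n (fun q => chartReading (b p) (b q) (X q)) p := by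
  have h := contMDiffAt_totalSpace.1 hX
  refine h.2.congr_of_eventuallyEq ?_
  filter_upwards [h.1.continuousAt.preimage_mem_nhds (chart_source_mem_nhds E (b p))] with q hq
  exact chartReading_apply (w := ⟨b q, X q⟩) hq

/-- The coefficients of a smooth map in a smoothly varying basis are smooth. -/
lemma exists_contMDiffAt_coefficients [FiniteDimensional ℝ E]
    {F : Type*} [NormedAddCommGroup F] [NormedSpace ℝ F]
    {H : Type*} [TopologicalSpace H] {J : ModelWithCorners ℝ F H} {P : Type*} [TopologicalSpace P]
    [ChartedSpace H P] {k : ℕ∞ω} {p : P} {a : Fin (Module.finrank ℝ E) → P → E} {z : P → E}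
    (ha : ∀ i, ContMDiffAt J 𝓘(ℝ, E) k (a i) p) (hz : ContMDiffAt J 𝓘(ℝ, E) k z p)
    (hspan : ∀ᶠ q in 𝓝 p, Submodule.span ℝ (range fun i => a i q) = ⊤) :
    ∃ c : Fin (Module.finrank ℝ E) → P → ℝ, (∀ i, ContMDiffAt J 𝓘(ℝ, ℝ) k (c i) p) ∧
      ∀ᶠ q in 𝓝 p, ∑ i, c i q • a i q = z q := by
  -- `B q` sends coefficients to the linear combination. As the index set has `finrank ℝ E`
  -- elements, spanning makes `B q` invertible, and inversion is smooth.
  let B : P → (Fin (Module.finrank ℝ E) → ℝ) →L[ℝ] E := fun q =>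
    ∑ i, (ContinuousLinearMap.proj (R := ℝ) (φ := fun _ => ℝ) i).smulRight (a i q)
  have hBapp : ∀ q c, B q c = ∑ i, c i • a i q := fun q c => by simp [B]
  have hB : ContMDiffAt J 𝓘(ℝ, (Fin (Module.finrank ℝ E) → ℝ) →L[ℝ] E) k B p := by
    refine contMDiffAt_finsetSum fun i _ => ?_
    exact ((ContinuousLinearMap.smulRightL ℝ (Fin (Module.finrank ℝ E) → ℝ) E
      (ContinuousLinearMap.proj (R := ℝ) (φ := fun _ => ℝ) i)).contDiff.contDiffAt
        |>.contMDiffAt).comp p (ha i)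
  have hBinv : ∀ q, Submodule.span ℝ (range fun i => a i q) = ⊤ →
      ∃ e : (Fin (Module.finrank ℝ E) → ℝ) ≃L[ℝ] E, (e : _ →L[ℝ] E) = B q := by
    intro q hq
    have hsurj : Function.Surjective (B q) := by
      intro ξ
      obtain ⟨c, hc⟩ := (Submodule.mem_span_range_iff_exists_fun ℝ).1
        (hq ▸ Submodule.mem_top : ξ ∈ Submodule.span ℝ (range fun i => a i q))
      exact ⟨c, by rw [hBapp, hc]⟩
    have hinj : Function.Injective (B q) :=
      (LinearMap.injective_iff_surjective_of_finrank_eq_finrank (f := (B q).toLinearMap)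
        (by simp)).2 hsurj
    exact ⟨(LinearEquiv.ofBijective (B q).toLinearMap ⟨hinj, hsurj⟩).toContinuousLinearEquiv,
      by ext; rfl⟩
  have hc : ContMDiffAt J 𝓘(ℝ, Fin (Module.finrank ℝ E) → ℝ) k
      (fun q => (B q).inverse (z q)) p := by
    obtain ⟨e, he⟩ := hBinv p hspan.self_of_nhds
    have h1 : ContDiffAt ℝ k ContinuousLinearMap.inverse (B p) := he ▸ contDiffAt_map_inverse e
    exact (h1.contMDiffAt.comp p hB).clm_apply hz
  refine ⟨fun i q => (B q).inverse (z q) i, fun i =>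
    ((ContinuousLinearMap.proj (R := ℝ) (φ := fun _ => ℝ) i).contDiff.contDiffAt
      |>.contMDiffAt).comp p hc, hspan.mono fun q hq => ?_⟩
  obtain ⟨e, he⟩ := hBinv q hq
  rw [← hBapp q]
  change B q ((B q).inverse (z q)) = z q
  rw [← he, ContinuousLinearMap.inverse_equiv]
  exact e.apply_symm_apply _

end ChartReading

/-! ### Existence, uniqueness and smoothness of horizontal lifts -/

section HorizontalLift

/-- The chart-constant extension `σ` of `v` is a local section of `π` through `v`, and `π ∘ σ = id`
gives a right inverse of `dπ_v`. -/
lemma dproj_surjective (v : TangentBundle 𝓘(ℝ, E) M) : Function.Surjective (dproj v) := by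
  set x₀ := v.proj
  have hx₀ : x₀ ∈ (chartAt E x₀).source := mem_chart_source E x₀
  set σ : M → TangentBundle 𝓘(ℝ, E) M := fun y => ⟨y, chartField x₀ (chartReading x₀ x₀ v.2) y⟩
  have hσ : σ x₀ = v := by
    simp only [σ, chartField_chartReading hx₀]
    rfl
  have hσd : MDifferentiableAt 𝓘(ℝ, E) 𝓘(ℝ, E).tangent σ x₀ :=
    ((smoothFieldOn_chartField x₀ _).contMDiffAt
      ((chartAt E x₀).open_source.mem_nhds hx₀)).mdifferentiableAt (by norm_num)
  intro ξ
  have hcomp : (dproj (σ x₀)).comp (mfderiv 𝓘(ℝ, E) 𝓘(ℝ, E).tangent σ x₀) =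
      mfderiv 𝓘(ℝ, E) 𝓘(ℝ, E) (id : M → M) x₀ :=
    (mfderiv_comp x₀ (I' := 𝓘(ℝ, E).tangent) (mdifferentiableAt_proj (TangentSpace 𝓘(ℝ, E)))
      hσd).symm
  rw [mfderiv_id] at hcomp
  have : ∀ w, σ x₀ = w → ∀ ξ : E, ∃ a : E × E, (dproj w a : E) = ξ := by
    rintro _ rfl ξ
    exact ⟨mfderiv 𝓘(ℝ, E) 𝓘(ℝ, E).tangent σ x₀ ξ, DFunLike.congr_fun hcomp ξ⟩
  exact this v hσ ξ

lemma contMDiff_tangentBundle_proj : ContMDiff 𝓘(ℝ, E).tangent 𝓘(ℝ, E) ∞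
    (fun w : TangentBundle 𝓘(ℝ, E) M => w.proj) :=
  contMDiff_proj (TangentSpace 𝓘(ℝ, E))

lemma contMDiffAt_dproj {v : TangentBundle 𝓘(ℝ, E) M}
    {Y : ∀ v : TangentBundle 𝓘(ℝ, E) M, TangentSpace 𝓘(ℝ, E).tangent v}
    (hY : ContMDiffAt 𝓘(ℝ, E).tangent 𝓘(ℝ, E).tangent.tangent ∞
      (fun w => (⟨w, Y w⟩ : TangentBundle 𝓘(ℝ, E).tangent (TangentBundle 𝓘(ℝ, E) M))) v) :
    ContMDiffAt 𝓘(ℝ, E).tangent 𝓘(ℝ, E).tangent ∞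
      (fun w => (⟨w.proj, dproj w (Y w)⟩ : TangentBundle 𝓘(ℝ, E) M)) v := by
  have h : ContMDiff 𝓘(ℝ, E).tangent.tangent 𝓘(ℝ, E).tangent ∞
      (tangentMap 𝓘(ℝ, E).tangent 𝓘(ℝ, E) (fun w : TangentBundle 𝓘(ℝ, E) M => w.proj)) :=
    contMDiff_tangentBundle_proj.contMDiff_tangentMap (by norm_num)
  exact ContMDiffAt.comp (x := v) (h _) hY

namespace NonlinearConnection

variable {A : Set (TangentBundle 𝓘(ℝ, E) M)} (N : NonlinearConnection A)

lemma exists_horizontal {v : TangentBundle 𝓘(ℝ, E) M} (hv : v ∈ A)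
    (ξ : TangentSpace 𝓘(ℝ, E) v.proj) : ∃ w ∈ N.horizontal v, dproj v w = ξ := by
  obtain ⟨w, hw⟩ := dproj_surjective v ξ
  obtain ⟨h, hh, k, hk, rfl⟩ := Submodule.mem_sup.1
    ((N.isCompl v hv).sup_eq_top ▸ Submodule.mem_top : w ∈ N.horizontal v ⊔ verticalSpace v)
  refine ⟨h, hh, ?_⟩
  have hk' : dproj v k = 0 := hk
  rw [← hw, map_add, hk', add_zero]

lemma eq_of_mem_horizontal {v : TangentBundle 𝓘(ℝ, E) M} (hv : v ∈ A)
    {w w' : TangentSpace 𝓘(ℝ, E).tangent v} (hw : w ∈ N.horizontal v) (hw' : w' ∈ N.horizontal v)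
    (h : dproj v w = dproj v w') : w = w' := by
  have hk : w - w' ∈ verticalSpace v := by
    change dproj v (w - w') = 0
    rw [map_sub, h, sub_self]
  exact sub_eq_zero.1 ((Submodule.disjoint_def.1 (N.isCompl v hv).disjoint) _
    (sub_mem hw hw') hk)

lemma horizontalLift_spec {v : TangentBundle 𝓘(ℝ, E) M} (hv : v ∈ A)
    (Z : ∀ v : TangentBundle 𝓘(ℝ, E) M, TangentSpace 𝓘(ℝ, E) v.proj) :
    N.horizontalLift Z v ∈ N.horizontal v ∧ dproj v (N.horizontalLift Z v) = Z v := by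
  have h := N.exists_horizontal hv (Z v)
  rw [horizontalLift, dif_pos h]
  exact h.choose_spec

lemma eq_horizontalLift {v : TangentBundle 𝓘(ℝ, E) M} (hv : v ∈ A)
    {Z : ∀ v : TangentBundle 𝓘(ℝ, E) M, TangentSpace 𝓘(ℝ, E) v.proj}
    {w : TangentSpace 𝓘(ℝ, E).tangent v} (hw : w ∈ N.horizontal v) (h : dproj v w = Z v) :
    w = N.horizontalLift Z v :=
  N.eq_of_mem_horizontal hv hw (N.horizontalLift_spec hv Z).1
    (h.trans (N.horizontalLift_spec hv Z).2.symm)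

/-- The horizontal lift of a smooth vector field is smooth. -/
lemma contMDiffAt_horizontalLift [FiniteDimensional ℝ E] (hA : IsOpen A)
    {v : TangentBundle 𝓘(ℝ, E) M} (hv : v ∈ A) {Z : ∀ x : M, TangentSpace 𝓘(ℝ, E) x} {U : Set M}
    (hU : IsOpen U) (hvU : v.proj ∈ U) (hZ : SmoothFieldOn Z U) :
    ContMDiffAt 𝓘(ℝ, E).tangent 𝓘(ℝ, E).tangent.tangent ∞
      (fun w => (⟨w, N.horizontalLift (isotropic Z) w⟩ :
        TangentBundle 𝓘(ℝ, E).tangent (TangentBundle 𝓘(ℝ, E) M))) v := by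
  obtain ⟨O, hO, hvO, Y, hY, hspan⟩ := N.exists_frame v hv
  have hYv : ∀ i, ContMDiffAt 𝓘(ℝ, E).tangent 𝓘(ℝ, E).tangent.tangent ∞
      (fun w => (⟨w, Y i w⟩ : TangentBundle 𝓘(ℝ, E).tangent (TangentBundle 𝓘(ℝ, E) M))) v :=
    fun i => (hY i).contMDiffAt (hO.mem_nhds hvO)
  have ha : ∀ i, ContMDiffAt 𝓘(ℝ, E).tangent 𝓘(ℝ, E) ∞
      (fun w => chartReading v.proj w.proj (dproj w (Y i w))) v :=
    fun i => contMDiffAt_chartReading (contMDiffAt_dproj (hYv i))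
  have hz : ContMDiffAt 𝓘(ℝ, E).tangent 𝓘(ℝ, E) ∞
      (fun w : TangentBundle 𝓘(ℝ, E) M => chartReading v.proj w.proj (Z w.proj)) v :=
    contMDiffAt_chartReading
      (b := fun w : TangentBundle 𝓘(ℝ, E) M => w.proj) (X := fun w => Z w.proj)
      (ContMDiffAt.comp (x := v) (hZ.contMDiffAt (hU.mem_nhds hvU)) (contMDiff_tangentBundle_proj v))
  have hnear : ∀ᶠ w in 𝓝 v, w ∈ A ∧ w ∈ O ∧ w.proj ∈ (chartAt E v.proj).source := by
    filter_upwards [hA.mem_nhds hv, hO.mem_nhds hvO,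
      contMDiff_tangentBundle_proj.continuous.continuousAt.preimage_mem_nhds (chart_source_mem_nhds E v.proj)]
      with w h1 h2 h3
    exact ⟨h1, h2, h3⟩
  have hsum : ∀ w (c : Fin (Module.finrank ℝ E) → ℝ),
      chartReading v.proj w.proj (dproj w (∑ i, c i • Y i w)) =
        ∑ i, c i • chartReading v.proj w.proj (dproj w (Y i w)) := by
    intro w c
    rw [map_sum, map_sum]
    exact Finset.sum_congr rfl fun i _ => by rw [map_smul, map_smul]
  -- The projected frame spans because every vector of the base has a horizontal lift, which is a
  -- combination of the frame.
  obtain ⟨c, hc, hcz⟩ := exists_contMDiffAt_coefficients ha hz (hnear.mono fun w hw => by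
    rw [Submodule.eq_top_iff']
    intro ξ
    obtain ⟨y, hy, hyξ⟩ := N.exists_horizontal hw.1 (chartField v.proj ξ w.proj)
    rw [hspan w ⟨hw.2.1, hw.1⟩, Submodule.mem_span_range_iff_exists_fun] at hy
    obtain ⟨c, rfl⟩ := hy
    rw [Submodule.mem_span_range_iff_exists_fun]
    exact ⟨c, by rw [← hsum, hyξ, chartReading_chartField hw.2.2]⟩)
  refine (ContMDiffAt.sum_section (s := Finset.univ)
    fun i _ => (hc i).smul_section (hYv i)).congr_of_eventuallyEq ?_
  filter_upwards [hnear, hcz] with w hw hcw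
  -- The coefficients of `Z` in the projected frame are those of its lift in the frame.
  have hlift : ∑ i, c i w • Y i w = N.horizontalLift (isotropic Z) w := by
    refine N.eq_horizontalLift hw.1 (Z := isotropic Z) ?_ ?_
    · rw [hspan w ⟨hw.2.1, hw.1⟩]
      exact Submodule.sum_mem _ fun i _ => Submodule.smul_mem _ _ (Submodule.subset_span ⟨i, rfl⟩)
    · rw [← hsum w (fun i => c i w)] at hcw
      have := congrArg (fun u => chartField v.proj u w.proj) hcw
      simp only [chartField_chartReading hw.2.2] at this
      exact this
  rw [← hlift]
  rfl

end NonlinearConnection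
end HorizontalLift

/-! ### Uniqueness of integral curves and the flow -/

section IntegralCurves

/-- Vectors over distinct points are separated in `M`, vectors over the same point in a
trivialization. Uniqueness of integral curves in `TM` relies on this. -/
instance t2Space_tangentBundle [T2Space M] : T2Space (TangentBundle 𝓘(ℝ, E) M) := by
  refine ⟨fun x y hxy => ?_⟩
  by_cases h : x.proj = y.proj
  · let e := trivializationAt E (TangentSpace 𝓘(ℝ, E) : M → Type _) x.proj
    have hx : x ∈ e.source := e.mem_source.2 (mem_baseSet_trivializationAt E _ x.proj)
    have hy : y ∈ e.source := e.mem_source.2 (h ▸ mem_baseSet_trivializationAt E _ x.proj)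
    obtain ⟨u, w, hu, hw, hxu, hyw, huw⟩ := t2_separation (e.injOn.ne hx hy hxy)
    exact ⟨e.source ∩ e ⁻¹' u, e.source ∩ e ⁻¹' w,
      e.toOpenPartialHomeomorph.isOpen_inter_preimage hu,
      e.toOpenPartialHomeomorph.isOpen_inter_preimage hw, ⟨hx, hxu⟩, ⟨hy, hyw⟩,
      (huw.preimage e).mono inter_subset_right inter_subset_right⟩
  · exact separated_by_continuous contMDiff_tangentBundle_proj.continuous h

section

variable {F : Type*} [NormedAddCommGroup F] [NormedSpace ℝ F] {H : Type*} [TopologicalSpace H]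
  {I : ModelWithCorners ℝ F H} {P : Type*} [TopologicalSpace P] [ChartedSpace H P]
  {γ γ' : ℝ → P} {Y : ∀ x : P, TangentSpace I x} {a b t₀ : ℝ}

/-- Integral curves on an open interval are unique if the vector field is `C¹` along one of
them. -/
lemma isMIntegralCurveOn_Ioo_eqOn_of_contMDiffAt [IsManifold I 1 P] [BoundarylessManifold I P]
    [T2Space P] (ht₀ : t₀ ∈ Ioo a b)
    (hY : ∀ t ∈ Ioo a b, ContMDiffAt I I.tangent 1 (fun x => (⟨x, Y x⟩ : TangentBundle I P)) (γ t))
    (hγ : IsMIntegralCurveOn γ Y (Ioo a b)) (hγ' : IsMIntegralCurveOn γ' Y (Ioo a b))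
    (h : γ t₀ = γ' t₀) : EqOn γ γ' (Ioo a b) := by
  have hcl : ∀ t ∈ Ioo a b, (∃ᶠ τ in 𝓝 t, γ τ = γ' τ) → γ t = γ' t := by
    intro t ht hf
    by_contra hne
    have hm := isOpen_Ioo.mem_nhds ht
    have h1 := (hγ.isMIntegralCurveAt hm).continuousAt
    have h2 := (hγ'.isMIntegralCurveAt hm).continuousAt
    exact hf ((h1.ne_iff_eventually_ne h2).1 hne)
  have hop : ∀ t ∈ Ioo a b, γ t = γ' t → γ =ᶠ[𝓝 t] γ' := fun t ht heq =>
    isMIntegralCurveAt_eventuallyEq_of_contMDiffAt_boundaryless (hY t ht)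
      (hγ.isMIntegralCurveAt (isOpen_Ioo.mem_nhds ht))
      (hγ'.isMIntegralCurveAt (isOpen_Ioo.mem_nhds ht)) heq
  -- Connectedness: the coincidence set is open by local uniqueness and relatively closed by the
  -- Hausdorff property.
  have hsub : Ioo a b ⊆ {t | t ∈ Ioo a b ∧ γ t = γ' t} := by
    refine isPreconnected_Ioo.subset_of_closure_inter_subset ?_ ⟨t₀, ht₀, ht₀, h⟩ ?_
    · rw [isOpen_iff_mem_nhds]
      rintro t ⟨ht, heq⟩
      filter_upwards [hop t ht heq, isOpen_Ioo.mem_nhds ht] with τ h1 h2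
      exact ⟨h2, h1⟩
    · rintro t ⟨ht, htI⟩
      exact ⟨htI, hcl t htI ((mem_closure_iff_frequently.1 ht).mono fun τ hτ => hτ.2)⟩
  exact fun t ht => (hsub ht).2

lemma isMIntegralCurveOn_congr {s : Set ℝ} (hγ : IsMIntegralCurveOn γ Y s) (h : EqOn γ' γ s) :
    IsMIntegralCurveOn γ' Y s := by
  intro t ht
  have h1 := (hγ t ht).congr_mono (fun τ hτ => h hτ) (h ht) subset_rfl
  have h2 : ∀ y, y = γ t → HasMFDerivWithinAt 𝓘(ℝ, ℝ) I γ' s t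
      (ContinuousLinearMap.smulRight (1 : ℝ →L[ℝ] ℝ) (Y y : F)) := by
    rintro _ rfl
    exact h1
  exact h2 _ (h ht)

end

/-- The flow is given by any integral curve. -/
lemma flow_eq_of_isMIntegralCurveOn [CompleteSpace E] [T2Space M]
    {Z : ∀ x : M, TangentSpace 𝓘(ℝ, E) x} (hZ : SmoothFieldOn Z univ) {γ : ℝ → M} {a b t : ℝ}
    (h0 : (0 : ℝ) ∈ Ioo a b) (hγ : IsMIntegralCurveOn γ Z (Ioo a b)) (ht : t ∈ Ioo a b) :
    flow Z t (γ 0) = γ t := by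
  have i1 : IsManifold 𝓘(ℝ, E) 1 M := IsManifold.of_le (n := ∞) (by norm_num)
  have hex : ∃ γ' : ℝ → M, γ' 0 = γ 0 ∧
      ∃ a b : ℝ, 0 ∈ Ioo a b ∧ t ∈ Ioo a b ∧ IsMIntegralCurveOn γ' Z (Ioo a b) :=
    ⟨γ, rfl, a, b, h0, ht, hγ⟩
  rw [flow, dif_pos hex]
  -- The curve chosen in `flow` may depend on `t` and have another domain; it is compared with `γ`
  -- on the common interval.
  obtain ⟨hc0, a', b', h0', ht', hc⟩ := hex.choose_spec
  have hI : Ioo a b ∩ Ioo a' b' = Ioo (max a a') (min b b') := Ioo_inter_Ioo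
  refine isMIntegralCurveOn_Ioo_eqOn_of_contMDiffAt (t₀ := 0) (hI ▸ ⟨h0, h0'⟩)
    (fun τ _ => ((contMDiffOn_univ.1 hZ).of_le (by norm_num)) _)
    (hc.mono (hI ▸ inter_subset_right)) (hγ.mono (hI ▸ inter_subset_left)) hc0 (hI ▸ ⟨ht, ht'⟩)

end IntegralCurves

/-! ### Parallel transport as an integral curve of the horizontal lift -/

section ParallelTransport

namespace NonlinearConnection

variable {A : Set (TangentBundle 𝓘(ℝ, E) M)} (N : NonlinearConnection A)

lemma isMIntegralCurveOn_proj {Z : ∀ x : M, TangentSpace 𝓘(ℝ, E) x}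
    {W : ℝ → TangentBundle 𝓘(ℝ, E) M} {a b : ℝ}
    (hW : IsMIntegralCurveOn W (N.horizontalLift (isotropic Z)) (Ioo a b))
    (hWA : ∀ t ∈ Ioo a b, W t ∈ A) :
    IsMIntegralCurveOn (fun t => (W t).proj) Z (Ioo a b) := by
  intro t ht
  have h1 : HasMFDerivAt 𝓘(ℝ, E).tangent 𝓘(ℝ, E)
      (fun w : TangentBundle 𝓘(ℝ, E) M => w.proj) (W t) (dproj (W t)) :=
    (contMDiff_tangentBundle_proj.mdifferentiable (by norm_num) (W t)).hasMFDerivAt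
  refine (h1.comp_hasMFDerivWithinAt t (hW t ht)).congr_mfderiv ?_
  have h2 := (N.horizontalLift_spec (hWA t ht) (isotropic Z)).2
  refine ContinuousLinearMap.ext_ring ?_
  change dproj (W t) ((1 : ℝ) • N.horizontalLift (isotropic Z) (W t)) = (1 : ℝ) • Z (W t).proj
  rw [map_smul, h2]
  rfl

/-- The velocity is horizontal and projects to `γ' = Z`; the horizontal space contains only one such
vector. -/
lemma isMIntegralCurveOn_of_isParallelOn {Z : ∀ x : M, TangentSpace 𝓘(ℝ, E) x} {γ : ℝ → M}
    {V : ∀ t : ℝ, TangentSpace 𝓘(ℝ, E) (γ t)} {a b : ℝ} (hV : N.IsParallelOn γ V (Ioo a b))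
    (hγ : IsMIntegralCurveOn γ Z (Ioo a b)) :
    IsMIntegralCurveOn (fun t => (⟨γ t, V t⟩ : TangentBundle 𝓘(ℝ, E) M))
      (N.horizontalLift (isotropic Z)) (Ioo a b) := by
  intro t ht
  obtain ⟨hA, hd, hh⟩ := hV t ht
  have h1 : HasMFDerivAt 𝓘(ℝ, E).tangent 𝓘(ℝ, E)
      (fun w : TangentBundle 𝓘(ℝ, E) M => w.proj) ⟨γ t, V t⟩ (dproj ⟨γ t, V t⟩) :=
    (contMDiff_tangentBundle_proj.mdifferentiable (by norm_num) _).hasMFDerivAt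
  have h2 := hasMFDerivAt_unique (h1.comp t hd.hasMFDerivAt)
    ((hγ t ht).hasMFDerivAt (isOpen_Ioo.mem_nhds ht))
  have h3 : dproj ⟨γ t, V t⟩ (mfderiv 𝓘(ℝ, ℝ) 𝓘(ℝ, E).tangent
      (fun τ => (⟨γ τ, V τ⟩ : TangentBundle 𝓘(ℝ, E) M)) t (1 : ℝ)) = Z (γ t) :=
    (DFunLike.congr_fun h2 (1 : ℝ)).trans (one_smul ℝ (Z (γ t) : E))
  have h4 := N.eq_horizontalLift (Z := isotropic Z) hA hh h3
  refine (hd.hasMFDerivAt.hasMFDerivWithinAt).congr_mfderiv ?_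
  refine ContinuousLinearMap.ext_ring ?_
  exact h4.trans (one_smul ℝ (N.horizontalLift (isotropic Z) ⟨γ t, V t⟩ : E × E)).symm

lemma isParallelOn_of_isMIntegralCurveOn {Z : ∀ x : M, TangentSpace 𝓘(ℝ, E) x} {γ : ℝ → M}
    {V : ∀ t : ℝ, TangentSpace 𝓘(ℝ, E) (γ t)} {a b : ℝ}
    (hA : ∀ t ∈ Ioo a b, (⟨γ t, V t⟩ : TangentBundle 𝓘(ℝ, E) M) ∈ A)
    (hV : IsMIntegralCurveOn (fun t => (⟨γ t, V t⟩ : TangentBundle 𝓘(ℝ, E) M))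
      (N.horizontalLift (isotropic Z)) (Ioo a b)) :
    N.IsParallelOn γ V (Ioo a b) := by
  intro t ht
  have h1 := (hV t ht).hasMFDerivAt (isOpen_Ioo.mem_nhds ht)
  refine ⟨hA t ht, h1.mdifferentiableAt, ?_⟩
  have h2 : mfderiv 𝓘(ℝ, ℝ) 𝓘(ℝ, E).tangent
      (fun τ => (⟨γ τ, V τ⟩ : TangentBundle 𝓘(ℝ, E) M)) t (1 : ℝ) =
      N.horizontalLift (isotropic Z) ⟨γ t, V t⟩ :=
    (DFunLike.congr_fun h1.mfderiv (1 : ℝ)).trans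
      (one_smul ℝ (N.horizontalLift (isotropic Z) ⟨γ t, V t⟩ : E × E))
  rw [h2]
  exact (N.horizontalLift_spec (hA t ht) (isotropic Z)).1

/-- Any parallel field along an integral curve of `Z` is an integral curve of the smooth field
`Z^H`, hence unique. The equality is stated in `TM` because `γ t` and `(W t).proj` agree only
propositionally. -/
lemma mk_parallelTransport_eq [FiniteDimensional ℝ E] [T2Space M] (hA : IsOpen A)
    {Z : ∀ x : M, TangentSpace 𝓘(ℝ, E) x} (hZ : SmoothFieldOn Z univ)
    {W : ℝ → TangentBundle 𝓘(ℝ, E) M} {ε : ℝ}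
    (hW : IsMIntegralCurveOn W (N.horizontalLift (isotropic Z)) (Ioo (-ε) ε))
    (hWA : ∀ t ∈ Ioo (-ε) ε, W t ∈ A) {γ : ℝ → M} (hγ : ∀ t ∈ Ioo (-ε) ε, γ t = (W t).proj)
    {t : ℝ} (ht : t ∈ Ioo (-ε) ε) :
    (⟨γ t, N.parallelTransport γ t (W 0)⟩ : TangentBundle 𝓘(ℝ, E) M) = W t := by
  classical
  have i1 : IsManifold 𝓘(ℝ, E).tangent 1 (TangentBundle 𝓘(ℝ, E) M) :=
    IsManifold.of_le (n := ∞) (by norm_num)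
  have h0 : (0 : ℝ) ∈ Ioo (-ε) ε := by
    have := ht.1.trans ht.2
    exact ⟨by linarith, by linarith⟩
  have hγZ : IsMIntegralCurveOn γ Z (Ioo (-ε) ε) :=
    isMIntegralCurveOn_congr (N.isMIntegralCurveOn_proj hW hWA) hγ
  have hex : ∃ V : ∀ τ : ℝ, TangentSpace 𝓘(ℝ, E) (γ τ),
      (⟨γ 0, V 0⟩ : TangentBundle 𝓘(ℝ, E) M) = W 0 ∧
      ∃ a b : ℝ, 0 ∈ Ioo a b ∧ t ∈ Ioo a b ∧ N.IsParallelOn γ V (Ioo a b) := by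
    -- `W` moved to the fibres over `γ`; the default `0` is never used on `Ioo (-ε) ε`.
    let V : ∀ τ : ℝ, TangentSpace 𝓘(ℝ, E) (γ τ) := fun τ =>
      if h : (W τ).proj = γ τ then h ▸ (W τ).2 else 0
    have hVW : ∀ τ ∈ Ioo (-ε) ε, (⟨γ τ, V τ⟩ : TangentBundle 𝓘(ℝ, E) M) = W τ := by
      intro τ hτ
      have h := (hγ τ hτ).symm
      have : V τ = h ▸ (W τ).2 := dif_pos h
      rw [this]
      have : ∀ (w : TangentBundle 𝓘(ℝ, E) M) (y : M) (h : w.proj = y),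
          (⟨y, h ▸ w.2⟩ : TangentBundle 𝓘(ℝ, E) M) = w := by
        rintro w _ rfl
        rfl
      exact this _ _ h
    exact ⟨V, hVW 0 h0, -ε, ε, h0, ht, N.isParallelOn_of_isMIntegralCurveOn
      (fun τ hτ => (hVW τ hτ).symm ▸ hWA τ hτ) (isMIntegralCurveOn_congr hW hVW)⟩
  rw [parallelTransport, dif_pos hex]
  obtain ⟨hV0, a, b, h0', ht', hV⟩ := hex.choose_spec
  have hI : Ioo (-ε) ε ∩ Ioo a b = Ioo (max (-ε) a) (min ε b) := Ioo_inter_Ioo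
  have hV' := N.isMIntegralCurveOn_of_isParallelOn
    (fun τ (hτ : τ ∈ Ioo (max (-ε) a) (min ε b)) => hV τ (show τ ∈ Ioo (-ε) ε ∩ Ioo a b from hI ▸ hτ).2)
    (hγZ.mono (hI ▸ inter_subset_left))
  exact (isMIntegralCurveOn_Ioo_eqOn_of_contMDiffAt (t₀ := 0) (hI ▸ ⟨h0, h0'⟩)
    (fun τ hτ => (N.contMDiffAt_horizontalLift hA (hWA τ (show τ ∈ Ioo (-ε) ε ∩ Ioo a b from hI ▸ hτ).1) isOpen_univ
      (mem_univ _) hZ).of_le (by norm_num))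
    (hW.mono (hI ▸ inter_subset_left)) hV' hV0.symm (hI ▸ ⟨ht, ht'⟩)).symm

end NonlinearConnection
end ParallelTransport

/-! ### Time derivative of the differential of the flow -/

section FlowDerivative

/-- A solution of the differential equation read in a chart gives an integral curve. -/
lemma isMIntegralCurveOn_extChartAt_symm {Z : ∀ x : M, TangentSpace 𝓘(ℝ, E) x} {x₀ : M}
    {c : ℝ → E} {a b : ℝ}
    (hc : ∀ t ∈ Ioo a b, HasDerivAt c (chartReading x₀ ((extChartAt 𝓘(ℝ, E) x₀).symm (c t))
      (Z ((extChartAt 𝓘(ℝ, E) x₀).symm (c t)))) t ∧ c t ∈ (extChartAt 𝓘(ℝ, E) x₀).target) :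
    IsMIntegralCurveOn ((extChartAt 𝓘(ℝ, E) x₀).symm ∘ c) Z (Ioo a b) := by
  have i1 : IsManifold 𝓘(ℝ, E) 1 M := IsManifold.of_le (n := ∞) (by norm_num)
  intro t ht
  obtain ⟨hd, htar⟩ := hc t ht
  have h1 : HasMFDerivAt 𝓘(ℝ, E) 𝓘(ℝ, E) (extChartAt 𝓘(ℝ, E) x₀).symm (c t)
      (mfderiv 𝓘(ℝ, E) 𝓘(ℝ, E) (extChartAt 𝓘(ℝ, E) x₀).symm (c t)) :=
    (((contMDiffOn_extChartAt_symm (n := 1) x₀).contMDiffAt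
      ((isOpen_extChartAt_target x₀).mem_nhds htar)).mdifferentiableAt one_ne_zero).hasMFDerivAt
  have h2 := mfderivWithin_extChartAt_symm_comp_mfderiv_extChartAt (I := 𝓘(ℝ, E)) htar
  rw [show range 𝓘(ℝ, E) = univ by simp, mfderivWithin_univ] at h2
  refine (HasMFDerivAt.comp t h1 hd.hasFDerivAt.hasMFDerivAt).hasMFDerivWithinAt.congr_mfderiv ?_
  refine ContinuousLinearMap.ext_ring ?_
  refine Eq.trans (b := (Z ((extChartAt 𝓘(ℝ, E) x₀).symm (c t)) : E)) ?_ (one_smul ℝ (_ : E)).symm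
  refine Eq.trans ?_ (DFunLike.congr_fun h2 (Z ((extChartAt 𝓘(ℝ, E) x₀).symm (c t))))
  refine congrArg (mfderiv 𝓘(ℝ, E) 𝓘(ℝ, E) (extChartAt 𝓘(ℝ, E) x₀).symm (c t)) ?_
  exact one_smul ℝ (_ : E)

/-- The differential of the flow, read in a chart, is differentiable with respect to time; its
derivative is the differential of the vector field. -/
lemma exists_hasDerivAt_mfderiv_flow [FiniteDimensional ℝ E] [T2Space M]
    {Z : ∀ x : M, TangentSpace 𝓘(ℝ, E) x} (hZ : SmoothFieldOn Z univ) (x₀ : M) :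
    ∃ (D : ℝ → E →L[ℝ] E) (D' : E →L[ℝ] E), HasDerivAt D D' 0 ∧
      (∀ u : TangentSpace 𝓘(ℝ, E) x₀, D' (chartReading x₀ x₀ u) =
        mvfderiv 𝓘(ℝ, E) (fun y => chartReading x₀ y (Z y)) x₀ u) ∧
      ∀ᶠ t in 𝓝 (0 : ℝ), ∀ u : TangentSpace 𝓘(ℝ, E) x₀,
        chartReading x₀ (flow Z t x₀) (mfderiv 𝓘(ℝ, E) 𝓘(ℝ, E) (flow Z t) x₀ u) =
          D t (chartReading x₀ x₀ u) := by
  have i1 : IsManifold 𝓘(ℝ, E) 1 M := IsManifold.of_le (n := ∞) (by norm_num)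
  have i2 : IsManifold 𝓘(ℝ, E) 2 M := IsManifold.of_le (n := ∞) (by norm_cast)
  have hx₀ : x₀ ∈ (extChartAt 𝓘(ℝ, E) x₀).source := mem_extChartAt_source x₀
  have hZr : ContMDiffAt 𝓘(ℝ, E) 𝓘(ℝ, E) ∞ (fun y => chartReading x₀ y (Z y)) x₀ :=
    contMDiffAt_chartReading (b := fun y : M => y) (X := Z) (contMDiffOn_univ.1 hZ x₀)
  let φ := extChartAt 𝓘(ℝ, E) x₀
  let z : E → E := fun p => chartReading x₀ (φ.symm p) (Z (φ.symm p))
  have hz : ContDiffAt ℝ 2 z (φ x₀) := by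
    have h1 : ContMDiffAt 𝓘(ℝ, E) 𝓘(ℝ, E) 2 φ.symm (φ x₀) :=
      (contMDiffOn_extChartAt_symm x₀).contMDiffAt (extChartAt_target_mem_nhds x₀)
    have h2 : ContMDiffAt 𝓘(ℝ, E) 𝓘(ℝ, E) 2 (fun y => chartReading x₀ y (Z y))
        (φ.symm (φ x₀)) := by
      rw [φ.left_inv hx₀]
      exact hZr.of_le (by norm_cast)
    exact (h2.comp _ h1).contDiffAt
  obtain ⟨ε, hε, α, D, hα, hD, hD'⟩ :=
    exists_localFlow_hasFDerivAt hz (extChartAt_target_mem_nhds (I := 𝓘(ℝ, E)) x₀)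
  have hφα : ∀ᶠ y in 𝓝 x₀, y ∈ φ.source ∧ α (φ y) 0 = φ y ∧ ∀ t ∈ Ioo (-ε) ε,
      HasDerivAt (α (φ y)) (z (α (φ y) t)) t ∧ α (φ y) t ∈ φ.target :=
    Filter.Eventually.and (extChartAt_source_mem_nhds (I := 𝓘(ℝ, E)) x₀)
      ((continuousAt_extChartAt (I := 𝓘(ℝ, E)) x₀).eventually hα)
  have h0 : (0 : ℝ) ∈ Ioo (-ε) ε := ⟨by linarith, hε⟩
  -- For fixed `t` the flow agrees with the chart flow on a whole neighbourhood of `x₀`, so their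
  -- differentials at `x₀` can be compared.
  have hflow : ∀ t ∈ Ioo (-ε) ε, flow Z t =ᶠ[𝓝 x₀] fun y => φ.symm (α (φ y) t) := by
    intro t ht
    filter_upwards [hφα] with y hy
    have h1 := flow_eq_of_isMIntegralCurveOn hZ h0 (isMIntegralCurveOn_extChartAt_symm hy.2.2) ht
    rwa [Function.comp_apply, hy.2.1, φ.left_inv hy.1] at h1
  refine ⟨D, fderiv ℝ z (φ x₀), hD', fun u => ?_, ?_⟩
  · refine (mvfderiv_of_eventuallyEq_comp_extChartAt hx₀ (hz.differentiableAt two_ne_zero) ?_ u).symm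
    filter_upwards [extChartAt_source_mem_nhds (I := 𝓘(ℝ, E)) x₀] with y hy
    have : ∀ y', y' = y → chartReading x₀ y (Z y) = chartReading x₀ y' (Z y') := by
      rintro _ rfl
      rfl
    exact this _ (φ.left_inv hy)
  · filter_upwards [isOpen_Ioo.mem_nhds h0] with t ht u
    have htar : α (φ x₀) t ∈ φ.target := (hφα.self_of_nhds.2.2 t ht).2
    have hx : flow Z t x₀ = φ.symm (α (φ x₀) t) := (hflow t ht).self_of_nhds
    have hsrc : flow Z t x₀ ∈ φ.source := hx ▸ φ.map_target htar
    have hcomp : φ ∘ flow Z t =ᶠ[𝓝 x₀] (fun p => α p t) ∘ φ := by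
      filter_upwards [hflow t ht, hφα] with y hy hy'
      rw [Function.comp_apply, hy, Function.comp_apply, φ.right_inv (hy'.2.2 t ht).2]
    have hfd : MDifferentiableAt 𝓘(ℝ, E) 𝓘(ℝ, E) (flow Z t) x₀ := by
      have h1 : MDifferentiableAt 𝓘(ℝ, E) 𝓘(ℝ, E) φ.symm (α (φ x₀) t) :=
        ((contMDiffOn_extChartAt_symm (n := 1) x₀).contMDiffAt
          ((isOpen_extChartAt_target x₀).mem_nhds htar)).mdifferentiableAt one_ne_zero
      have h2 : MDifferentiableAt 𝓘(ℝ, E) 𝓘(ℝ, E) (fun p => α p t) (φ x₀) :=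
        (hD t ht).differentiableAt.mdifferentiableAt
      have h3 : MDifferentiableAt 𝓘(ℝ, E) 𝓘(ℝ, E) φ x₀ :=
        mdifferentiableAt_extChartAt (mem_chart_source E x₀)
      exact ((h1.comp (φ x₀) h2).comp x₀ h3).congr_of_eventuallyEq (hflow t ht)
    have h4 := mfderiv_comp_apply (I := 𝓘(ℝ, E)) (I' := 𝓘(ℝ, E)) (I'' := 𝓘(ℝ, E)) (f := flow Z t)
      (g := φ) x₀ (mdifferentiableAt_extChartAt (by simpa [φ] using hsrc)) hfd u
    have h5 := mvfderiv_of_eventuallyEq_comp_extChartAt hx₀ (hD t ht).differentiableAt hcomp u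
    rw [(hD t ht).fderiv] at h5
    exact h4.symm.trans h5

end FlowDerivative

/-! ### The anisotropic bracket of fields and the form in a chart -/

section LieDerivative

lemma mvfderiv_of_eventuallyEq_comp_proj {G : Type*} [NormedAddCommGroup G] [NormedSpace ℝ G]
    {v : TangentBundle 𝓘(ℝ, E) M} {g : M → G} {f : TangentBundle 𝓘(ℝ, E) M → G}
    (hg : MDifferentiableAt 𝓘(ℝ, E) 𝓘(ℝ, G) g v.proj) (hf : f =ᶠ[𝓝 v] fun w => g w.proj)
    (ξ : TangentSpace 𝓘(ℝ, E).tangent v) :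
    mvfderiv 𝓘(ℝ, E).tangent f v ξ = mvfderiv 𝓘(ℝ, E) g v.proj (dproj v ξ) := by
  have h1 : HasMFDerivAt 𝓘(ℝ, E).tangent 𝓘(ℝ, E)
      (fun w : TangentBundle 𝓘(ℝ, E) M => w.proj) v (dproj v) :=
    (contMDiff_tangentBundle_proj.mdifferentiable (by norm_num) v).hasMFDerivAt
  exact DFunLike.congr_fun
    ((hg.hasMFDerivAt.comp v h1).congr_of_eventuallyEq hf).mfderiv ξ

/-- The derivative of a function along an integral curve. -/
lemma hasDerivAt_comp_of_isMIntegralCurveOn {F : Type*} [NormedAddCommGroup F] [NormedSpace ℝ F]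
    {H : Type*} [TopologicalSpace H] {I : ModelWithCorners ℝ F H} {P : Type*} [TopologicalSpace P]
    [ChartedSpace H P] {G : Type*} [NormedAddCommGroup G] [NormedSpace ℝ G]
    {γ : ℝ → P} {Y : ∀ x : P, TangentSpace I x} {a b t : ℝ} {f : P → G}
    (hγ : IsMIntegralCurveOn γ Y (Ioo a b)) (ht : t ∈ Ioo a b)
    (hf : MDifferentiableAt I 𝓘(ℝ, G) f (γ t)) :
    HasDerivAt (fun τ => f (γ τ)) (mvfderiv I f (γ t) (Y (γ t))) t := by
  have h := hf.hasMFDerivAt.comp t ((hγ t ht).hasMFDerivAt (isOpen_Ioo.mem_nhds ht))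
  let L : ℝ →L[ℝ] G :=
    (mfderiv I 𝓘(ℝ, G) f (γ t)).comp ((1 : ℝ →L[ℝ] ℝ).smulRight (Y (γ t) : F))
  have h2 : HasFDerivAt (fun τ => f (γ τ)) L t := hasMFDerivAt_iff_hasFDerivAt.1 h
  have h3 : L 1 = mvfderiv I f (γ t) (Y (γ t)) :=
    congrArg (mfderiv I 𝓘(ℝ, G) f (γ t)) (one_smul ℝ (Y (γ t) : F))
  exact h3 ▸ h2.hasDerivAt

namespace NonlinearConnection

variable {A : Set (TangentBundle 𝓘(ℝ, E) M)} (N : NonlinearConnection A)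

/-- The anisotropic Lie bracket of isotropic fields, read in a chart. -/
lemma chartReading_lieBracketField [FiniteDimensional ℝ E] (hA : IsOpen A)
    {v : TangentBundle 𝓘(ℝ, E) M} (hv : v ∈ A) {Z X : ∀ x : M, TangentSpace 𝓘(ℝ, E) x}
    {U : Set M} (hU : IsOpen U) (hvU : v.proj ∈ U) (hZ : SmoothFieldOn Z U)
    (hX : SmoothFieldOn X U) :
    chartReading v.proj v.proj (N.lieBracketField (isotropic Z) (isotropic X) v) =
      mvfderiv 𝓘(ℝ, E) (fun y => chartReading v.proj y (X y)) v.proj (Z v.proj) -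
        mvfderiv 𝓘(ℝ, E) (fun y => chartReading v.proj y (Z y)) v.proj (X v.proj) := by
  have i1 : IsManifold 𝓘(ℝ, E) 1 M := IsManifold.of_le (n := ∞) (by norm_num)
  have i2 : IsManifold 𝓘(ℝ, E) 2 M := IsManifold.of_le (n := ∞) (by norm_cast)
  have hnear : ∀ᶠ w in 𝓝 v, w ∈ A ∧ w.proj ∈ (chartAt E v.proj).source :=
    Filter.Eventually.and (hA.mem_nhds hv)
      (contMDiff_tangentBundle_proj.continuous.continuousAt.preimage_mem_nhds
        (chart_source_mem_nhds E v.proj))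
  -- The commutator formula is applied to the vector-valued function `chart ∘ π`, whose differential
  -- is the chart reading of `dπ`. Its derivative along a lift `Y^H` is again pulled back from `M`,
  -- by `hder`.
  have hF : ∀ w : TangentBundle 𝓘(ℝ, E) M, w.proj ∈ (chartAt E v.proj).source →
      ∀ ξ : TangentSpace 𝓘(ℝ, E).tangent w,
      mvfderiv 𝓘(ℝ, E).tangent (fun w => extChartAt 𝓘(ℝ, E) v.proj w.proj) w ξ =
        chartReading v.proj w.proj (dproj w ξ) := fun w hw ξ =>
    mvfderiv_of_eventuallyEq_comp_proj (mdifferentiableAt_extChartAt hw) EventuallyEq.rfl ξ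
  have hFs : ContMDiffAt 𝓘(ℝ, E).tangent 𝓘(ℝ, E) 2
      (fun w : TangentBundle 𝓘(ℝ, E) M => extChartAt 𝓘(ℝ, E) v.proj w.proj) v :=
    (contMDiffAt_extChartAt (n := 2)).comp v
      ((contMDiff_tangentBundle_proj v).of_le (by norm_cast))
  have hlift : ∀ Y : ∀ x : M, TangentSpace 𝓘(ℝ, E) x, SmoothFieldOn Y U →
      MDifferentiableAt 𝓘(ℝ, E).tangent 𝓘(ℝ, E).tangent.tangent
        (fun w => (⟨w, N.horizontalLift (isotropic Y) w⟩ :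
          TangentBundle 𝓘(ℝ, E).tangent (TangentBundle 𝓘(ℝ, E) M))) v := fun Y hY =>
    (N.contMDiffAt_horizontalLift hA hv hU hvU hY).mdifferentiableAt (by norm_num)
  have hder : ∀ Y : ∀ x : M, TangentSpace 𝓘(ℝ, E) x, SmoothFieldOn Y U →
      ∀ ξ : TangentSpace 𝓘(ℝ, E).tangent v,
      mvfderiv 𝓘(ℝ, E).tangent (fun w =>
        mvfderiv 𝓘(ℝ, E).tangent (fun w => extChartAt 𝓘(ℝ, E) v.proj w.proj) w
          (N.horizontalLift (isotropic Y) w)) v ξ =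
        mvfderiv 𝓘(ℝ, E) (fun y => chartReading v.proj y (Y y)) v.proj (dproj v ξ) := by
    intro Y hY ξ
    have hYr : ContMDiffAt 𝓘(ℝ, E) 𝓘(ℝ, E) ∞ (fun y => chartReading v.proj y (Y y)) v.proj :=
      contMDiffAt_chartReading (b := fun y : M => y) (X := Y) (hY.contMDiffAt (hU.mem_nhds hvU))
    refine mvfderiv_of_eventuallyEq_comp_proj (hYr.mdifferentiableAt (by norm_num)) ?_ ξ
    filter_upwards [hnear] with w hw
    rw [hF w hw.2, (N.horizontalLift_spec hw.1 _).2]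
    rfl
  have h := mvfderiv_apply_mlieBracket hFs (hlift Z hZ) (hlift X hX)
  rw [hF v (mem_chart_source E v.proj), hder X hX, hder Z hZ,
    (N.horizontalLift_spec hv _).2, (N.horizontalLift_spec hv _).2] at h
  exact h

lemma exists_isMIntegralCurveOn_horizontalLift [FiniteDimensional ℝ E] (hA : IsOpen A)
    {v : TangentBundle 𝓘(ℝ, E) M} (hv : v ∈ A) {Z : ∀ x : M, TangentSpace 𝓘(ℝ, E) x}
    (hZ : SmoothFieldOn Z univ) :
    ∃ W : ℝ → TangentBundle 𝓘(ℝ, E) M, W 0 = v ∧ ∃ ε > 0,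
      IsMIntegralCurveOn W (N.horizontalLift (isotropic Z)) (Ioo (-ε) ε) ∧
      ∀ t ∈ Ioo (-ε) ε, W t ∈ A ∧ (W t).proj ∈ (chartAt E v.proj).source := by
  have i1 : IsManifold 𝓘(ℝ, E).tangent 1 (TangentBundle 𝓘(ℝ, E) M) :=
    IsManifold.of_le (n := ∞) (by norm_num)
  obtain ⟨W, hW0, hW⟩ := exists_isMIntegralCurveAt_of_contMDiffAt_boundaryless (t₀ := 0)
    ((N.contMDiffAt_horizontalLift hA hv isOpen_univ (mem_univ _) hZ).of_le
      (by norm_num : (1 : ℕ∞ω) ≤ ∞))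
  have hnear : ∀ᶠ w in 𝓝 (W 0), w ∈ A ∧ w.proj ∈ (chartAt E v.proj).source := by
    rw [hW0]
    exact Filter.Eventually.and (hA.mem_nhds hv)
      (contMDiff_tangentBundle_proj.continuous.continuousAt.preimage_mem_nhds
        (chart_source_mem_nhds E v.proj))
  obtain ⟨s, hs, hWs⟩ := (isMIntegralCurveAt_iff).1 hW
  obtain ⟨ε, hε, hball⟩ := Metric.mem_nhds_iff.1 (inter_mem hs (hW.continuousAt hnear))
  rw [Real.ball_eq_Ioo, zero_sub, zero_add] at hball
  exact ⟨W, hW0, ε, hε, hWs.mono fun t ht => (hball ht).1, fun t ht => (hball ht).2⟩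

end NonlinearConnection

/-- No regularity of `Z` is needed: a chosen curve starts at `x`, and the default value is `x`. -/
lemma flow_zero {E : Type*} [NormedAddCommGroup E] [NormedSpace ℝ E] {M : Type*}
    [TopologicalSpace M] [ChartedSpace E M] (Z : ∀ x : M, TangentSpace 𝓘(ℝ, E) x) : flow Z 0 = id := by
  funext x
  rw [flow]
  split_ifs with h
  · exact h.choose_spec.1
  · rfl

namespace AnisotropicForm

variable {A : Set (TangentBundle 𝓘(ℝ, E) M)} {s : ℕ} (η : AnisotropicForm A s)

/-- The form `η` at `w`, read in the chart at `x₀`. -/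
def chartForm (x₀ : M) (w : TangentBundle 𝓘(ℝ, E) M) :
    MultilinearMap ℝ (fun _ : Fin s => E) ℝ :=
  (η.form w).toMultilinearMap.compLinearMap fun _ =>
    ((trivializationAt E (TangentSpace 𝓘(ℝ, E)) x₀).symmL ℝ w.proj).toLinearMap

lemma chartForm_apply (x₀ : M) (w : TangentBundle 𝓘(ℝ, E) M) (u : Fin s → E) :
    η.chartForm x₀ w u = η.form w fun i => chartField x₀ (u i) w.proj := rfl

lemma form_eq_chartForm {x₀ : M} {w : TangentBundle 𝓘(ℝ, E) M}
    (hw : w.proj ∈ (chartAt E x₀).source) (ξ : Fin s → TangentSpace 𝓘(ℝ, E) w.proj) :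
    η.form w ξ = η.chartForm x₀ w fun i => chartReading x₀ w.proj (ξ i) := by
  rw [chartForm_apply]
  congr 1
  funext i
  exact (chartField_chartReading hw _).symm

end AnisotropicForm

end LieDerivative

/-! ### Bracket and pullback of a form in a chart -/

section LieDerivativeFormula

variable {A : Set (TangentBundle 𝓘(ℝ, E) M)}
  {N : NonlinearConnection A} {Z : ∀ x : M, TangentSpace 𝓘(ℝ, E) x} {s : ℕ}
  {η : AnisotropicForm A s} {W : ℝ → TangentBundle 𝓘(ℝ, E) M} {ε : ℝ}

/-- The derivative along a horizontal curve of a form read in a chart. -/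
lemma AnisotropicForm.hasDerivAt_chartForm (hA : IsOpen A)
    (hW : IsMIntegralCurveOn W (N.horizontalLift (isotropic Z)) (Ioo (-ε) ε)) (hε : 0 < ε)
    (hWA : W 0 ∈ A) (u : Fin s → E) :
    HasDerivAt (fun t => η.chartForm (W 0).proj (W t) u)
      (mvfderiv 𝓘(ℝ, E).tangent (fun w => η.chartForm (W 0).proj w u) (W 0)
        (N.horizontalLift (isotropic Z) (W 0))) 0 := by
  have h1 := η.smooth _ (chartAt E (W 0).proj).open_source _
    fun i => smoothFieldOn_chartField (W 0).proj (u i)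
  have h2 : A ∩ {v | v.proj ∈ (chartAt E (W 0).proj).source} ∈ 𝓝 (W 0) :=
    inter_mem (hA.mem_nhds hWA)
      (contMDiff_tangentBundle_proj.continuous.continuousAt.preimage_mem_nhds
        (chart_source_mem_nhds E _))
  exact hasDerivAt_comp_of_isMIntegralCurveOn hW ⟨neg_lt_zero.2 hε, hε⟩
    ((h1.contMDiffAt h2).mdifferentiableAt (by norm_num))

/-- The Lie bracket of a form in terms of its reading in a chart along the integral curve of the
horizontal lift. -/
lemma lieBracketForm_eq [FiniteDimensional ℝ E] (hA : IsOpen A) (hZ : SmoothFieldOn Z univ)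
    (hW : IsMIntegralCurveOn W (N.horizontalLift (isotropic Z)) (Ioo (-ε) ε)) (hε : 0 < ε)
    (hWA : ∀ t ∈ Ioo (-ε) ε, W t ∈ A ∧ (W t).proj ∈ (chartAt E (W 0).proj).source)
    {U : Set M} (hU : IsOpen U) (hWU : (W 0).proj ∈ U)
    {X : Fin s → ∀ x : M, TangentSpace 𝓘(ℝ, E) x} (hX : ∀ i, SmoothFieldOn (X i) U) :
    N.lieBracketForm (isotropic Z) η X (W 0) =
      mvfderiv 𝓘(ℝ, E).tangent (fun w => η.chartForm (W 0).proj w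
          fun i => chartReading (W 0).proj (W 0).proj (X i (W 0).proj)) (W 0)
        (N.horizontalLift (isotropic Z) (W 0)) +
      ∑ i, η.chartForm (W 0).proj (W 0)
        (Function.update (fun i => chartReading (W 0).proj (W 0).proj (X i (W 0).proj)) i
          (mvfderiv 𝓘(ℝ, E) (fun y => chartReading (W 0).proj y (Z y)) (W 0).proj
            (X i (W 0).proj))) := by
  have h0 : (0 : ℝ) ∈ Ioo (-ε) ε := ⟨neg_lt_zero.2 hε, hε⟩
  have hXr : ∀ i, ContMDiffAt 𝓘(ℝ, E) 𝓘(ℝ, E) ∞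
      (fun y => chartReading (W 0).proj y (X i y)) (W 0).proj := fun i =>
    contMDiffAt_chartReading (b := fun y : M => y) (X := X i)
      ((hX i).contMDiffAt (hU.mem_nhds hWU))
  have hXW : ∀ i, HasDerivAt (fun t => chartReading (W 0).proj (W t).proj (X i (W t).proj))
      (mvfderiv 𝓘(ℝ, E) (fun y => chartReading (W 0).proj y (X i y)) (W 0).proj
        (Z (W 0).proj)) 0 := by
    intro i
    have hd := (hXr i).mdifferentiableAt (by norm_num : (∞ : ℕ∞ω) ≠ 0)
    have h1 := hasDerivAt_comp_of_isMIntegralCurveOn hW h0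
      (f := fun w : TangentBundle 𝓘(ℝ, E) M => chartReading (W 0).proj w.proj (X i w.proj))
      (MDifferentiableAt.comp (W 0) hd
        (contMDiff_tangentBundle_proj.mdifferentiable (by norm_num) (W 0)))
    rw [mvfderiv_of_eventuallyEq_comp_proj hd EventuallyEq.rfl,
      (N.horizontalLift_spec (hWA 0 h0).1 _).2] at h1
    exact h1
  have hηX : HasDerivAt (fun t => η.form (W t) fun i => X i (W t).proj)
      (mvfderiv 𝓘(ℝ, E).tangent (fun w => η.form w fun i => X i w.proj) (W 0)
        (N.horizontalLift (isotropic Z) (W 0))) 0 := by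
    have h1 := η.smooth U hU X hX
    have h2 : A ∩ {v | v.proj ∈ U} ∈ 𝓝 (W 0) :=
      inter_mem (hA.mem_nhds (hWA 0 h0).1)
        (contMDiff_tangentBundle_proj.continuous.continuousAt.preimage_mem_nhds
          (hU.mem_nhds hWU))
    exact hasDerivAt_comp_of_isMIntegralCurveOn hW h0
      ((h1.contMDiffAt h2).mdifferentiableAt (by norm_num))
  have hprod := hasDerivAt_multilinear_apply
    (fun u => η.hasDerivAt_chartForm hA hW hε (hWA 0 h0).1 u) hXW
  -- The function `η(X₁, …, X_s)` along `W` is differentiated directly and by the product rule.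
  have heq := hηX.unique (hprod.congr_of_eventuallyEq (by
    filter_upwards [isOpen_Ioo.mem_nhds h0] with t ht
    exact η.form_eq_chartForm (hWA t ht).2 _))
  have hterm : ∀ i, η.form (W 0) (Function.update (fun i => X i (W 0).proj) i
      (N.lieBracketField (isotropic Z) (isotropic (X i)) (W 0))) =
      η.chartForm (W 0).proj (W 0)
        (Function.update (fun i => chartReading (W 0).proj (W 0).proj (X i (W 0).proj)) i
          (mvfderiv 𝓘(ℝ, E) (fun y => chartReading (W 0).proj y (X i y)) (W 0).proj
            (Z (W 0).proj))) -
      η.chartForm (W 0).proj (W 0)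
        (Function.update (fun i => chartReading (W 0).proj (W 0).proj (X i (W 0).proj)) i
          (mvfderiv 𝓘(ℝ, E) (fun y => chartReading (W 0).proj y (Z y)) (W 0).proj
            (X i (W 0).proj))) := by
    intro i
    rw [η.form_eq_chartForm (hWA 0 h0).2, ← MultilinearMap.map_update_sub,
      ← N.chartReading_lieBracketField hA (hWA 0 h0).1 hU hWU (hZ.mono (subset_univ U)) (hX i)]
    congr 1
    funext j
    exact Function.apply_update (fun _ => chartReading (W 0).proj (W 0).proj) _ i _ j
  have hlie : N.lieBracketForm (isotropic Z) η X (W 0) =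
      mvfderiv 𝓘(ℝ, E).tangent (fun w => η.form w fun i => X i w.proj) (W 0)
        (N.horizontalLift (isotropic Z) (W 0)) -
      ∑ i, η.form (W 0) (Function.update (fun i => X i (W 0).proj) i
        (N.lieBracketField (isotropic Z) (isotropic (X i)) (W 0))) := rfl
  rw [hlie, heq, Finset.sum_congr rfl fun i _ => hterm i, Finset.sum_sub_distrib]
  ring

/-- The pullback of a form by the flow, read in a chart. -/
lemma flowPullback_apply_eq [FiniteDimensional ℝ E] [T2Space M] (hA : IsOpen A) (hZ : SmoothFieldOn Z univ)
    (hW : IsMIntegralCurveOn W (N.horizontalLift (isotropic Z)) (Ioo (-ε) ε))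
    (hWA : ∀ t ∈ Ioo (-ε) ε, W t ∈ A ∧ (W t).proj ∈ (chartAt E (W 0).proj).source)
    {t : ℝ} (ht : t ∈ Ioo (-ε) ε) (u : Fin s → TangentSpace 𝓘(ℝ, E) (W 0).proj) :
    flowPullback N Z t η (W 0) u = η.chartForm (W 0).proj (W t) fun i =>
      chartReading (W 0).proj (flow Z t (W 0).proj)
        (mfderiv 𝓘(ℝ, E) 𝓘(ℝ, E) (flow Z t) (W 0).proj (u i)) := by
  have h0 : (0 : ℝ) ∈ Ioo (-ε) ε := by
    have := ht.1.trans ht.2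
    exact ⟨by linarith, by linarith⟩
  have hmk := N.mk_parallelTransport_eq hA hZ hW (fun t ht => (hWA t ht).1)
    (γ := fun τ => flow Z τ (W 0).proj) (fun t ht => flow_eq_of_isMIntegralCurveOn hZ h0
      (N.isMIntegralCurveOn_proj hW fun t ht => (hWA t ht).1) ht) ht
  -- A free `w` lets the equality `hmk` of points of `TM` be substituted despite the dependent type
  -- of `ξ`.
  have key : ∀ w, w = W t → ∀ ξ : Fin s → TangentSpace 𝓘(ℝ, E) w.proj,
      η.form w ξ = η.chartForm (W 0).proj (W t) fun i =>
        chartReading (W 0).proj w.proj (ξ i) := by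
    rintro _ rfl ξ
    exact η.form_eq_chartForm (hWA t ht).2 ξ
  exact key _ hmk _

end LieDerivativeFormula

end AnisotropicLie

end

/-! ### The Lie bracket as the derivative of the pullback -/

/-- The bracket takes local fields, so the limit is tested on fields `X`. The quotient sees only
their values at `π(v)`, and chart-constant fields realize every tuple of vectors there; hence the
bracket depends only on these values. -/
theorem mainTheorem8 {E : Type*} [NormedAddCommGroup E] [NormedSpace ℝ E]
    [FiniteDimensional ℝ E] {M : Type*} [TopologicalSpace M] [T2Space M] [ChartedSpace E M]
    [IsManifold 𝓘(ℝ, E) ∞ M] {A : Set (TangentBundle 𝓘(ℝ, E) M)} (hA : IsOpen A)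
    (N : AnisotropicLie.NonlinearConnection A)
    (Z : ∀ x : M, TangentSpace 𝓘(ℝ, E) x) (hZ : AnisotropicLie.SmoothFieldOn Z univ)
    {s : ℕ} (η : AnisotropicLie.AnisotropicForm A s)
    (v : TangentBundle 𝓘(ℝ, E) M) (hv : v ∈ A)
    (U : Set M) (hU : IsOpen U) (hvU : v.proj ∈ U)
    (X : Fin s → ∀ x : M, TangentSpace 𝓘(ℝ, E) x)
    (hX : ∀ i, AnisotropicLie.SmoothFieldOn (X i) U) :
    Tendsto
      (fun t : ℝ => (t⁻¹ • (AnisotropicLie.flowPullback N Z t η v - η.form v))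
        (fun i => X i v.proj))
      (𝓝[≠] 0)
      (𝓝 (N.lieBracketForm (AnisotropicLie.isotropic Z) η X v)) := by
  open AnisotropicLie in
  obtain ⟨W, rfl, ε, hε, hW, hWA⟩ := N.exists_isMIntegralCurveOn_horizontalLift hA hv hZ
  have h0 : (0 : ℝ) ∈ Ioo (-ε) ε := ⟨neg_lt_zero.2 hε, hε⟩
  obtain ⟨D, D', hD, hD', hDt⟩ := exists_hasDerivAt_mfderiv_flow hZ (W 0).proj
  have hD0 : ∀ u : TangentSpace 𝓘(ℝ, E) (W 0).proj,
      D 0 (chartReading (W 0).proj (W 0).proj u) = chartReading (W 0).proj (W 0).proj u := by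
    intro u
    rw [← hDt.self_of_nhds u, flow_zero, mfderiv_id]
    rfl
  have hder := hasDerivAt_multilinear_apply
    (fun u => η.hasDerivAt_chartForm hA hW hε (hWA 0 h0).1 u)
    (U := fun t i => D t (chartReading (W 0).proj (W 0).proj (X i (W 0).proj)))
    (U' := fun i => D' (chartReading (W 0).proj (W 0).proj (X i (W 0).proj)))
    fun i => by simpa using hD.clm_apply (hasDerivAt_const (0 : ℝ) _)
  -- With `D 0 = id` and `D' = dz` on the readings, the product rule takes exactly the form of
  -- `lieBracketForm_eq`.
  simp only [hD0, hD'] at hder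
  rw [← lieBracketForm_eq hA hZ hW hε hWA hU hvU hX, hasDerivAt_iff_tendsto_slope] at hder
  refine hder.congr' ?_
  filter_upwards [mem_nhdsWithin_of_mem_nhds (isOpen_Ioo.mem_nhds h0),
    mem_nhdsWithin_of_mem_nhds hDt] with t ht hDt
  rw [AlternatingMap.smul_apply, AlternatingMap.sub_apply,
    flowPullback_apply_eq hA hZ hW hWA ht, slope_def_module, sub_zero,
    η.form_eq_chartForm (hWA 0 h0).2]
  simp only [hD0, hDt]
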